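/- Let $\mathbf n=\{n_k\}_{k\ge1}$ be integers with $n_k\ge 2$ and $\mathbf c=\{c_k\}_{k\ge1}$ reals in $(0,1)$ with $(n_k-1)c_k<1$ for all $k$. The uniform Cantor set is $E=E(\mathbf n,\mathbf c)=\bigcap_{k\ge0}E_k$, where $E_0=[0,1]$ and $E_k$ is obtained from $E_{k-1}$ by deleting from each component $I$ of $E_{k-1}$ $n_k-1$ open intervals of equal length $c_k|I|$ so that the remaining $n_k$ closed intervals have equal length. For a word $w=i_1\cdots i_k$ with $1\le i_j\le n_j$ let $I_w$ be the corresponding component of $E_k$ (the components of $E_k$ inside $I_w$, for $w$ of length $k-1$, are $I_{w1},\dots,I_{wn_k}$ from left to right, and $I_w=[0,1]$ for the empty word). Let $\delta_k=\prod_{i=1}^k\frac{1-(n_i-1)c_i}{n_i}$ and $\varepsilon_k=c_k\delta_{k-1}$ be the lengths of the components of $E_k$ and of the gaps of level $k$. Put $\Lambda=\{k\ge1:\varepsilon_k<\delta_k\}$, and for $k\in\Lambda$ let $m_k\geq 1$ be the unique integer with $\delta_{k+m_k}\le\varepsilon_k<\delta_{k+m_k-1}$ and $s_k\geq 1$ the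 unique integer with $$s_k\delta_{k+m_k}+(s_k-1)\varepsilon_{k+m_k}\le\varepsilon_k<(s_k+1)\delta_{k+m_k}+s_k\varepsilon_{k+m_k}.$$ A vector $v=(v_1,\dots,v_N)$ with positive entries is called $(C,s)$-uniform ($1\le s\le N$) if $$C^{-1}\le\frac{v_{i+1}+\cdots+v_{i+l}}{v_{j+1}+\cdots+v_{j+l}}\le C\quad\text{whenever } 0\le i\le j\le i+l\le j+l\le N \text{ and } s\le l\le N,$$ and $C$-uniform if it is $(C,1)$-uniform; $(v,v)$ denotes $(v_1,\dots,v_N,v_1,\dots,v_N)$. A Borel measure $\mu$ on a metric space $X$ is doubling if there is $C\ge1$ with $0<\mu(B(x,2r))\le C\mu(B(x,r))<\infty$ for all $x\in X$, $r>0$. Let $\mathbb P=\{P_k\}_{k\ge1}$, $P_k=(p_{k,1},\dots,p_{k,n_k})$, be vectors with positive entries and $\sum_{i=1}^{n_k}p_{k,i}=1$. There is a unique Borel probability measure $\mu_{\mathbb P}$ on $E$ with $\mu_{\mathbb P}(I_{wi})=p_{k,i}\,\mu_{\mathbb P}(I_w)$ for all $k\ge1$, all words $w$ of length $k-1$ and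 all $1\le i\le n_k$ (where $\mu_{\mathbb P}(I_w)$ means $\mu_{\mathbb P}(I_w\cap E)$). **Theorem.** $\mu_{\mathbb P}$ is doubling on $E$ if and only if there is a constant $C>1$ such that every $P_k$, $k\ge1$, is $C$-uniform and, for each $k\in\Lambda$: (a) for all $1\le t<m_k$, $(P_{k+t},P_{k+t})$ is $C$-uniform and $$C^{-1}\prod_{j=1}^tp_{k+j,1}\le\prod_{j=1}^tp_{k+j,n_{k+j}}\le C\prod_{j=1}^tp_{k+j,1};$$ (b) $(P_{k+m_k},P_{k+m_k})$ is $(C,s_k)$-uniform. -/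

import Mathlib

namespace UniformCantor

noncomputable section

/-- Words `w = i₁i₂⋯i_k` of length `k` with `1 ≤ i_j ≤ n_j`; `Word.snoc w i` is the word `wi`. -/
inductive Word (n : ℕ → ℕ) : ℕ → Type
  | nil : Word n 0
  | snoc {k : ℕ} (w : Word n k) (i : ℕ) (hi : i ∈ Finset.Icc 1 (n (k + 1))) : Word n (k + 1)

/-- `δ_k`, the length of a component of level `k`: a component of level `k` splits into `n_{k+1}`
closed intervals of equal length, after removal of `n_{k+1} - 1` open intervals of length
`c_{k+1} δ_k`. -/
def compLength (n : ℕ → ℕ) (c : ℕ → ℝ) : ℕ → ℝ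
  | 0 => 1
  | k + 1 => (1 - ((n (k + 1) : ℝ) - 1) * c (k + 1)) / (n (k + 1) : ℝ) * compLength n c k

/-- `ε_k = c_k δ_{k-1}`, the length of a gap of level `k ≥ 1`. -/
def gapLength (n : ℕ → ℕ) (c : ℕ → ℝ) (k : ℕ) : ℝ := c k * compLength n c (k - 1)

/-- The left endpoint of the component `I_w`; the children `I_{w1}, I_{w2}, …` of `I_w` are
numbered from left to right. -/
def leftEnd (n : ℕ → ℕ) (c : ℕ → ℝ) : {k : ℕ} → Word n k → ℝ
  | _, .nil => 0
  | _, .snoc (k := k) w i _ =>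
      leftEnd n c w + ((i : ℝ) - 1) * (compLength n c (k + 1) + gapLength n c (k + 1))

/-- The component `I_w` of level `k` labelled by the word `w` of length `k`. -/
def component (n : ℕ → ℕ) (c : ℕ → ℝ) {k : ℕ} (w : Word n k) : Set ℝ :=
  Set.Icc (leftEnd n c w) (leftEnd n c w + compLength n c k)

/-- `E_k`, the union of the components of level `k`. -/
def level (n : ℕ → ℕ) (c : ℕ → ℝ) (k : ℕ) : Set ℝ := ⋃ w : Word n k, component n c w

/-- The uniform Cantor set `E(n, c) = ⋂ E_k`. -/
def cantorSet (n : ℕ → ℕ) (c : ℕ → ℝ) : Set ℝ := ⋂ k : ℕ, level n c k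

/-- Admissible parameters: `n_k ≥ 2`, `c_k ∈ (0,1)` and `(n_k - 1) c_k < 1` for all `k ≥ 1`
(the values at index `0` play no role). -/
def Admissible (n : ℕ → ℕ) (c : ℕ → ℝ) : Prop :=
  ∀ k : ℕ, 1 ≤ k → 2 ≤ n k ∧ 0 < c k ∧ c k < 1 ∧ ((n k : ℝ) - 1) * c k < 1

/-- `v = (v_1, …, v_N)` is a positive probability vector. Vectors of length `N` are
represented by functions on `ℕ` of which only the values at `1, …, N` are used. -/
def IsPosProb (N : ℕ) (v : ℕ → ℝ) : Prop :=
  (∀ i ∈ Finset.Icc 1 N, 0 < v i) ∧ ∑ i ∈ Finset.Icc 1 N, v i = 1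

/-- `P_1, P_2, …` is an `n`-matching sequence of positive probability vectors
`P_k = (p_{k,1}, …, p_{k,n_k})`. -/
def IsMatching (n : ℕ → ℕ) (P : ℕ → ℕ → ℝ) : Prop :=
  ∀ k : ℕ, 1 ≤ k → IsPosProb (n k) (P k)

/-- `v_{i+1} + ⋯ + v_{i+l}`. -/
def blockSum (v : ℕ → ℝ) (i l : ℕ) : ℝ := ∑ a ∈ Finset.Icc (i + 1) (i + l), v a

/-- `v = (v_1, …, v_N)` is `(C, s)`-uniform. -/
def IsUniformFrom (C : ℝ) (s N : ℕ) (v : ℕ → ℝ) : Prop :=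
  ∀ i j l : ℕ, s ≤ l → l ≤ N → i ≤ j → j ≤ i + l → i + l ≤ j + l → j + l ≤ N →
    C⁻¹ ≤ blockSum v i l / blockSum v j l ∧ blockSum v i l / blockSum v j l ≤ C

/-- `v = (v_1, …, v_N)` is `C`-uniform. -/
def IsUniform (C : ℝ) (N : ℕ) (v : ℕ → ℝ) : Prop := IsUniformFrom C 1 N v

/-- The vector `(v, v) = (v_1, …, v_N, v_1, …, v_N)` of length `2 N`. -/
def dbl (N : ℕ) (v : ℕ → ℝ) : ℕ → ℝ := fun i => if i ≤ N then v i else v (i - N)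

/-- `Λ = {k ≥ 1 : ε_k < δ_k}`. -/
def Lam (n : ℕ → ℕ) (c : ℕ → ℝ) : Set ℕ := {k | 1 ≤ k ∧ gapLength n c k < compLength n c k}

/-- The property defining `m = m_k`. -/
def IsM (n : ℕ → ℕ) (c : ℕ → ℝ) (k m : ℕ) : Prop :=
  1 ≤ m ∧ compLength n c (k + m) ≤ gapLength n c k ∧
    gapLength n c k < compLength n c (k + m - 1)

/-- `m_k`, for `k ∈ Λ` (see `existsUnique_isM`). -/
def mIndex (n : ℕ → ℕ) (c : ℕ → ℝ) (k : ℕ) : ℕ := sInf {m | IsM n c k m}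

/-- The property defining `s = s_k`. -/
def IsS (n : ℕ → ℕ) (c : ℕ → ℝ) (k s : ℕ) : Prop :=
  1 ≤ s ∧
    (s : ℝ) * compLength n c (k + mIndex n c k)
        + ((s : ℝ) - 1) * gapLength n c (k + mIndex n c k) ≤ gapLength n c k ∧
    gapLength n c k < ((s : ℝ) + 1) * compLength n c (k + mIndex n c k)
        + (s : ℝ) * gapLength n c (k + mIndex n c k)

/-- `s_k`, for `k ∈ Λ` (see `existsUnique_isS`). -/
def sIndex (n : ℕ → ℕ) (c : ℕ → ℝ) (k : ℕ) : ℕ := sInf {s | IsS n c k s}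

/-- `μ` is the probability measure `μ_P` on `E(n, c)` determined by `P`:
`μ(I_{wi}) = p_{k,i} μ(I_w)` for all words `w` of length `k - 1` and `1 ≤ i ≤ n_k`. -/
def IsMuP (n : ℕ → ℕ) (c : ℕ → ℝ) (P : ℕ → ℕ → ℝ)
    (μ : MeasureTheory.Measure (cantorSet n c)) : Prop :=
  MeasureTheory.IsProbabilityMeasure μ ∧
    ∀ (k : ℕ) (w : Word n k) (i : ℕ) (hi : i ∈ Finset.Icc 1 (n (k + 1))),
      μ (Subtype.val ⁻¹' component n c (w.snoc i hi)) =
        ENNReal.ofReal (P (k + 1) i) * μ (Subtype.val ⁻¹' component n c w)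

/-- A Borel measure on a metric space is doubling. -/
def IsDoubling {X : Type*} [MetricSpace X] [MeasurableSpace X] [BorelSpace X]
    (μ : MeasureTheory.Measure X) : Prop :=
  ∃ C : NNReal, 1 ≤ C ∧ ∀ (x : X) (r : ℝ), 0 < r →
    0 < μ (Metric.ball x (2 * r)) ∧
      μ (Metric.ball x (2 * r)) ≤ C * μ (Metric.ball x r) ∧
      C * μ (Metric.ball x r) < ⊤

/-! The numbers `m_k` and `s_k` are well defined. -/

theorem compLength_pos {n : ℕ → ℕ} {c : ℕ → ℝ} (h : Admissible n c) (k : ℕ) :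
    0 < compLength n c k := by
  induction k with
  | zero => simp [compLength]
  | succ k ih =>
    obtain ⟨h1, -, -, h4⟩ := h (k + 1) (by omega)
    have : (2 : ℝ) ≤ n (k + 1) := by exact_mod_cast h1
    exact mul_pos (div_pos (by linarith) (by linarith)) ih

theorem compLength_succ_le {n : ℕ → ℕ} {c : ℕ → ℝ} (h : Admissible n c) (k : ℕ) :
    compLength n c (k + 1) ≤ 1 / 2 * compLength n c k := by
  obtain ⟨h1, h2, -, h4⟩ := h (k + 1) (by omega)
  have h5 : (2 : ℝ) ≤ n (k + 1) := by exact_mod_cast h1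
  have h6 : 0 ≤ ((n (k + 1) : ℝ) - 1) * c (k + 1) := mul_nonneg (by linarith) h2.le
  refine mul_le_mul_of_nonneg_right ?_ (compLength_pos h k).le
  rw [div_le_div_iff₀ (by linarith) (by norm_num)]
  linarith

theorem compLength_strictAnti {n : ℕ → ℕ} {c : ℕ → ℝ} (h : Admissible n c) :
    StrictAnti (compLength n c) :=
  strictAnti_nat_of_succ_lt fun k => by
    have := compLength_succ_le h k
    have := compLength_pos h k
    linarith

theorem gapLength_pos {n : ℕ → ℕ} {c : ℕ → ℝ} (h : Admissible n c) {k : ℕ} (hk : 1 ≤ k) :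
    0 < gapLength n c k :=
  mul_pos (h k hk).2.1 (compLength_pos h _)

theorem existsUnique_isM {n : ℕ → ℕ} {c : ℕ → ℝ} (h : Admissible n c) {k : ℕ}
    (hk : k ∈ Lam n c) : ∃! m, IsM n c k m := by
  classical
  obtain ⟨hk1, hk2⟩ := hk
  have hanti := (compLength_strictAnti h).antitone
  have hle : ∀ m, compLength n c (k + m) ≤ (1 / 2 : ℝ) ^ m * compLength n c k := by
    intro m
    induction m with
    | zero => simp
    | succ m ih =>
      have := compLength_succ_le h (k + m)
      rw [pow_succ]
      rw [show k + (m + 1) = k + m + 1 by omega]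
      linarith
  have hex : ∃ m, compLength n c (k + m) ≤ gapLength n c k := by
    have hd := compLength_pos h k
    obtain ⟨m, hm⟩ := exists_pow_lt_of_lt_one (div_pos (gapLength_pos h hk1) hd)
      (by norm_num : (1 / 2 : ℝ) < 1)
    exact ⟨m, (hle m).trans ((lt_div_iff₀ hd).1 hm).le⟩
  have h0 : Nat.find hex ≠ 0 := by
    intro h0
    have := Nat.find_spec hex
    rw [h0] at this
    simp only [add_zero] at this
    linarith
  refine ⟨Nat.find hex, ⟨by omega, Nat.find_spec hex, ?_⟩, ?_⟩
  · have := Nat.find_min hex (m := Nat.find hex - 1) (by omega)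
    rw [show k + Nat.find hex - 1 = k + (Nat.find hex - 1) by omega]
    exact not_le.1 this
  · rintro m ⟨hm1, hm2, hm3⟩
    refine le_antisymm ?_ (Nat.find_min' hex hm2)
    by_contra hlt
    have := hanti (show k + Nat.find hex ≤ k + m - 1 by omega)
    have := Nat.find_spec hex
    linarith

theorem isM_mIndex {n : ℕ → ℕ} {c : ℕ → ℝ} (h : Admissible n c) {k : ℕ}
    (hk : k ∈ Lam n c) : IsM n c k (mIndex n c k) :=
  Nat.sInf_mem (existsUnique_isM h hk).exists

theorem existsUnique_isS {n : ℕ → ℕ} {c : ℕ → ℝ} (h : Admissible n c) {k : ℕ}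
    (hk : k ∈ Lam n c) : ∃! s, IsS n c k s := by
  obtain ⟨hm1, hm2, -⟩ := isM_mIndex h hk
  have hd := compLength_pos h (k + mIndex n c k)
  have he := gapLength_pos h (k := k + mIndex n c k) (by omega)
  unfold IsS
  set d := compLength n c (k + mIndex n c k)
  set e := gapLength n c (k + mIndex n c k)
  set g := gapLength n c k
  have hde : 0 < d + e := by linarith
  have hx : 0 ≤ (g + e) / (d + e) := div_nonneg (by linarith) hde.le
  refine ⟨⌊(g + e) / (d + e)⌋₊, ⟨?_, ?_, ?_⟩, ?_⟩
  · rw [Nat.le_floor_iff hx, le_div_iff₀ hde]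
    push_cast
    linarith
  · have := Nat.floor_le hx
    rw [le_div_iff₀ hde] at this
    linarith
  · have := Nat.lt_floor_add_one ((g + e) / (d + e))
    rw [div_lt_iff₀ hde] at this
    linarith
  · rintro s ⟨-, h2, h3⟩
    symm
    rw [Nat.floor_eq_iff hx, le_div_iff₀ hde, div_lt_iff₀ hde]
    constructor <;> linarith

theorem isS_sIndex {n : ℕ → ℕ} {c : ℕ → ℝ} (h : Admissible n c) {k : ℕ}
    (hk : k ∈ Lam n c) : IsS n c k (sIndex n c k) :=
  Nat.sInf_mem (existsUnique_isS h hk).exists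

end

end UniformCantor

namespace UniformCantor

noncomputable section

open MeasureTheory

variable {n : ℕ → ℕ} {c : ℕ → ℝ} {P : ℕ → ℕ → ℝ} {m : Set ℝ → ℝ}

/-! Doubling compares masses in two situations: inside a component, where runs of siblings are
compared, and across a gap, where the last children of one component face the first children of its
neighbour. The conditions on `P` say that both comparisons hold at all relevant scales.

Let two components of level `K` be neighbours across a gap of length ε_k (`Nbr`). Their addresses
part at level `k` into consecutive siblings, then follow last children on the left and first
children on the right. Their masses are therefore a common factor times p_{k,i}, resp. p_{k,i+1},
times the products in (a) (`Nbr.mass_eq`). The two sides must balance as long as ε_k < δ_K, that is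
K < k + m_k. At level k + m_k components fit into the gap, and runs facing each other must balance
only once they are about as long as the gap; their number of children is then at least s_k, whence
(b).

Necessity: if a set `A` contains the trace on `E` of a ball of size comparable to the distance to
`B`, doubling bounds m(B) by m(A) (`DoublingWith.le`). Runs of three or more children contain such a
ball. Shorter runs are treated through endpoints of `E` and endpoints of gaps. This yields
`nbr_mass_comparable`, `sumUniform_of_doubling` and `ends_comparable`; `sumUniform_dbl` turns
comparability of initial and final sums into uniformity of (v,v).

Sufficiency: take `K` with δ_{K+1} < 2r ≤ δ_K and the component of level `K` containing `x`. Inside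
it a ball is sandwiched between windows of children, and uniformity applies (`doubling_inside`). On
either side the ball of radius 2r can spill only into one neighbour, and the spill is dominated by
mass inside the component (`ball_inter_right_le`, `ball_inter_left_le`). If 2r > δ_0, the root alone
suffices.

The measure is the image of a product measure on digit sequences (`exists_isMuP`), unique because
cylinders form a generating π-system. The analysis uses only the set function S ↦ μ(S ∩ E) through
`IsMass`. -/

/-- The distance between the left endpoints of consecutive siblings of level `k`. -/
def stride (n : ℕ → ℕ) (c : ℕ → ℝ) (k : ℕ) : ℝ := compLength n c k + gapLength n c k

local notation "δ" => compLength n c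
local notation "ε" => gapLength n c
local notation "τ" => stride n c
local notation "E" => cantorSet n c

/-! ### Positions of components, children and endpoints. -/

theorem compLength_eq (h : Admissible n c) (k : ℕ) :
    δ k = n (k + 1) * τ (k + 1) - ε (k + 1) := by
  have h1 : (2 : ℝ) ≤ n (k + 1) := by exact_mod_cast (h (k + 1) (by omega)).1
  simp only [stride, compLength, gapLength, Nat.add_sub_cancel]
  field_simp
  ring

theorem gap_pos (h : Admissible n c) (k : ℕ) : 0 < ε (k + 1) := gapLength_pos h (by omega)

theorem compLength_lt_stride (h : Admissible n c) (k : ℕ) : δ (k + 1) < τ (k + 1) := by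
  have := gap_pos h k
  simp only [stride]; linarith

theorem stride_pos (h : Admissible n c) (k : ℕ) : 0 < τ (k + 1) :=
  (compLength_pos h _).trans (compLength_lt_stride h k)

theorem two_le (h : Admissible n c) (k : ℕ) : 2 ≤ n (k + 1) := (h (k + 1) (by omega)).1

/-- The `a`-th child of `I_w`. -/
def child (n : ℕ → ℕ) (c : ℕ → ℝ) {k : ℕ} (w : Word n k) (a : ℕ) : Set ℝ :=
  Set.Icc (leftEnd n c w + ((a : ℝ) - 1) * stride n c (k + 1))
    (leftEnd n c w + ((a : ℝ) - 1) * stride n c (k + 1) + compLength n c (k + 1))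

theorem component_snoc {k : ℕ} (w : Word n k) (i : ℕ) (hi : i ∈ Finset.Icc 1 (n (k + 1))) :
    component n c (w.snoc i hi) = child n c w i := rfl

theorem leftEnd_snoc {k : ℕ} (w : Word n k) (i : ℕ) (hi : i ∈ Finset.Icc 1 (n (k + 1))) :
    leftEnd n c (w.snoc i hi) = leftEnd n c w + ((i : ℝ) - 1) * τ (k + 1) := rfl

theorem sub_one_mul_stride_nonneg (h : Admissible n c) (k : ℕ) {a : ℕ}
    (ha : 1 ≤ a) : 0 ≤ ((a : ℝ) - 1) * τ (k + 1) := by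
  have h1 : (1 : ℝ) ≤ a := by exact_mod_cast ha
  exact mul_nonneg (by linarith) (stride_pos h k).le

theorem mul_stride_le (h : Admissible n c) (k : ℕ) {a : ℕ} (ha : a ≤ n (k + 1)) :
    ((a : ℝ) - 1) * τ (k + 1) + δ (k + 1) ≤ δ k := by
  have h2 : (a : ℝ) ≤ n (k + 1) := by exact_mod_cast ha
  have h3 := mul_le_mul_of_nonneg_right h2 (stride_pos h k).le
  have h4 := compLength_eq h k
  have h5 : τ (k + 1) = δ (k + 1) + ε (k + 1) := rfl
  linarith

theorem child_subset (h : Admissible n c) {k : ℕ} (w : Word n k) {a : ℕ}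
    (ha : a ∈ Finset.Icc 1 (n (k + 1))) : child n c w a ⊆ component n c w := by
  rw [Finset.mem_Icc] at ha
  have h1 := sub_one_mul_stride_nonneg h k ha.1
  have h2 := mul_stride_le h k ha.2
  exact Set.Icc_subset_Icc (by linarith) (by linarith)

theorem leftEnd_mem (h : Admissible n c) {k : ℕ} (w : Word n k) :
    leftEnd n c w ∈ component n c w := by
  have := compLength_pos h k
  exact ⟨le_rfl, by linarith⟩

theorem rightEnd_mem (h : Admissible n c) {k : ℕ} (w : Word n k) :
    leftEnd n c w + δ k ∈ component n c w := by
  have := compLength_pos h k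
  exact ⟨by linarith, le_rfl⟩

/-- At the first level where two addresses differ, a gap of that level separates them, so the
minimum of 1 and the gap lengths up to level `k` works. A margin independent of the words makes each
cylinder open in `E`. -/
theorem exists_separation (h : Admissible n c) (k : ℕ) :
    ∃ η : ℝ, 0 < η ∧ ∀ w w' : Word n k, w ≠ w' →
      leftEnd n c w + δ k + η ≤ leftEnd n c w' ∨ leftEnd n c w' + δ k + η ≤ leftEnd n c w := by
  induction k with
  | zero => exact ⟨1, one_pos, fun w w' hne => absurd (by cases w; cases w'; rfl) hne⟩
  | succ k ih =>
    obtain ⟨η, hη, ih⟩ := ih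
    have hg := gap_pos h k
    refine ⟨min η (ε (k + 1)), lt_min hη hg, ?_⟩
    have key : ∀ (a b : ℕ), a < b →
        ((a : ℝ) - 1) * τ (k + 1) + δ (k + 1) + ε (k + 1) ≤ ((b : ℝ) - 1) * τ (k + 1) := by
      intro a b hab
      have h1 : (a : ℝ) + 1 ≤ b := by exact_mod_cast hab
      have h3 := mul_le_mul_of_nonneg_right h1 (stride_pos h k).le
      have h5 : τ (k + 1) = δ (k + 1) + ε (k + 1) := rfl
      linarith
    have m1 := min_le_left η (ε (k + 1))
    have m2 := min_le_right η (ε (k + 1))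
    intro w w' hne
    cases w with | snoc w a ha =>
    cases w' with | snoc w' b hb =>
    simp only [leftEnd_snoc]
    rw [Finset.mem_Icc] at ha hb
    by_cases hw : w = w'
    · subst hw
      have hab : a ≠ b := fun hab => hne (by subst hab; rfl)
      rcases lt_or_gt_of_ne hab with hlt | hlt
      · left; have := key a b hlt; linarith
      · right; have := key b a hlt; linarith
    · have a1 := sub_one_mul_stride_nonneg h k ha.1
      have a2 := mul_stride_le h k ha.2
      have b1 := sub_one_mul_stride_nonneg h k hb.1
      have b2 := mul_stride_le h k hb.2
      rcases ih w w' hw with h1 | h1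
      · left; linarith
      · right; linarith

theorem separated (h : Admissible n c) {k : ℕ} {w w' : Word n k} (hne : w ≠ w') :
    leftEnd n c w + δ k < leftEnd n c w' ∨ leftEnd n c w' + δ k < leftEnd n c w := by
  obtain ⟨η, hη, hs⟩ := exists_separation h k
  rcases hs w w' hne with h1 | h1
  · left; linarith
  · right; linarith

theorem eq_of_mem (h : Admissible n c) {k : ℕ} {w w' : Word n k} {x : ℝ}
    (hx : x ∈ component n c w) (hx' : x ∈ component n c w') : w = w' := by
  by_contra hne
  have h1 := hx.1; have h2 := hx.2; have h3 := hx'.1; have h4 := hx'.2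
  rcases separated h hne with h5 | h5 <;> linarith

theorem exists_component {x : ℝ} (hx : x ∈ E) (k : ℕ) : ∃ w : Word n k, x ∈ component n c w :=
  Set.mem_iUnion.1 (Set.mem_iInter.1 hx k)

theorem exists_child (h : Admissible n c) {x : ℝ} (hx : x ∈ E) {k : ℕ} {w : Word n k}
    (hw : x ∈ component n c w) : ∃ a ∈ Finset.Icc 1 (n (k + 1)), x ∈ child n c w a := by
  obtain ⟨v, hv⟩ := exists_component hx (k + 1)
  cases v with | snoc v a ha =>
  rw [component_snoc] at hv
  obtain rfl := eq_of_mem h hw (child_subset h v ha hv)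
  exact ⟨a, ha, hv⟩

theorem cantorSet_subset : E ⊆ Set.Icc 0 1 := by
  intro x hx
  obtain ⟨w, hw⟩ := exists_component hx 0
  cases w
  simpa [component, leftEnd, compLength] using hw

theorem level_succ_subset (h : Admissible n c) (k : ℕ) :
    level n c (k + 1) ⊆ level n c k := by
  intro x hx
  obtain ⟨v, hv⟩ := Set.mem_iUnion.1 hx
  cases v with | snoc v a ha =>
  exact Set.mem_iUnion.2 ⟨v, child_subset h v ha hv⟩

theorem mem_cantorSet_of_forall_ge (h : Admissible n c) {k : ℕ} {x : ℝ}
    (hx : ∀ j, k ≤ j → x ∈ level n c j) : x ∈ E := by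
  have hanti : Antitone (level n c) := antitone_nat_of_succ_le (level_succ_subset h)
  refine Set.mem_iInter.2 fun j => ?_
  exact hanti (le_max_right k j) (hx _ (le_max_left k j))

theorem one_mem (h : Admissible n c) (k : ℕ) : 1 ∈ Finset.Icc 1 (n (k + 1)) :=
  Finset.mem_Icc.2 ⟨le_rfl, by have := two_le h k; omega⟩

theorem last_mem (h : Admissible n c) (k : ℕ) : n (k + 1) ∈ Finset.Icc 1 (n (k + 1)) :=
  Finset.mem_Icc.2 ⟨by have := two_le h k; omega, le_rfl⟩

theorem leftEnd_snoc_one {k : ℕ} (w : Word n k) (h1 : 1 ∈ Finset.Icc 1 (n (k + 1))) :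
    leftEnd n c (w.snoc 1 h1) = leftEnd n c w := by
  simp [leftEnd_snoc]

theorem rightEnd_snoc_last (h : Admissible n c) {k : ℕ} (w : Word n k)
    (h1 : n (k + 1) ∈ Finset.Icc 1 (n (k + 1))) :
    leftEnd n c (w.snoc (n (k + 1)) h1) + δ (k + 1) = leftEnd n c w + δ k := by
  have h4 := compLength_eq h k
  have h5 : τ (k + 1) = δ (k + 1) + ε (k + 1) := rfl
  rw [leftEnd_snoc]
  linarith

/-- A first child keeps the left endpoint of its parent, so the point survives at every deeper
level. -/
theorem leftEnd_mem_cantorSet (h : Admissible n c) {k : ℕ} (w : Word n k) :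
    leftEnd n c w ∈ E := by
  have key : ∀ j, k ≤ j → ∃ v : Word n j, leftEnd n c v = leftEnd n c w := by
    intro j hj
    induction j, hj using Nat.le_induction with
    | base => exact ⟨w, rfl⟩
    | succ j _ ih =>
      obtain ⟨v, hv⟩ := ih
      exact ⟨v.snoc 1 (one_mem h j), by rw [leftEnd_snoc_one, hv]⟩
  refine mem_cantorSet_of_forall_ge (k := k) h fun j hj => ?_
  obtain ⟨v, hv⟩ := key j hj
  exact Set.mem_iUnion.2 ⟨v, hv ▸ leftEnd_mem h v⟩

theorem rightEnd_mem_cantorSet (h : Admissible n c) {k : ℕ} (w : Word n k) :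
    leftEnd n c w + δ k ∈ E := by
  have key : ∀ j, k ≤ j → ∃ v : Word n j, leftEnd n c v + δ j = leftEnd n c w + δ k := by
    intro j hj
    induction j, hj using Nat.le_induction with
    | base => exact ⟨w, rfl⟩
    | succ j _ ih =>
      obtain ⟨v, hv⟩ := ih
      exact ⟨v.snoc _ (last_mem h j), by rw [rightEnd_snoc_last h, hv]⟩
  refine mem_cantorSet_of_forall_ge (k := k) h fun j hj => ?_
  obtain ⟨v, hv⟩ := key j hj
  exact Set.mem_iUnion.2 ⟨v, hv ▸ rightEnd_mem h v⟩

theorem exists_leftmost (h : Admissible n c) (k : ℕ) : ∃ w : Word n k, leftEnd n c w = 0 := by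
  induction k with
  | zero => exact ⟨.nil, rfl⟩
  | succ k ih =>
    obtain ⟨w, hw⟩ := ih
    exact ⟨w.snoc 1 (one_mem h k), by rw [leftEnd_snoc_one, hw]⟩

theorem exists_rightmost (h : Admissible n c) (k : ℕ) :
    ∃ w : Word n k, leftEnd n c w + δ k = 1 := by
  induction k with
  | zero => exact ⟨.nil, by simp [leftEnd, compLength]⟩
  | succ k ih =>
    obtain ⟨w, hw⟩ := ih
    exact ⟨w.snoc _ (last_mem h k), by rw [rightEnd_snoc_last h, hw]⟩

/-! ### Neighbouring components across a gap. -/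

/-- `Nbr k i w w'`: the component `I_{w'}` is the right neighbour of `I_w`, and the two lie in
the consecutive siblings with numbers `i`, `i + 1` of level `k`. -/
inductive Nbr : (k i : ℕ) → {K : ℕ} → Word n K → Word n K → Prop
  | base {k : ℕ} (u : Word n k) (i : ℕ) (hi : i ∈ Finset.Icc 1 (n (k + 1)))
      (hi' : i + 1 ∈ Finset.Icc 1 (n (k + 1))) : Nbr (k + 1) i (u.snoc i hi) (u.snoc (i + 1) hi')
  | step {k i K : ℕ} {w w' : Word n K} (hw : Nbr k i w w')
      (hl : n (K + 1) ∈ Finset.Icc 1 (n (K + 1))) (h1 : 1 ∈ Finset.Icc 1 (n (K + 1))) :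
      Nbr k i (w.snoc (n (K + 1)) hl) (w'.snoc 1 h1)

theorem Nbr.bounds {k i K : ℕ} {w w' : Word n K} (hw : Nbr k i w w') :
    1 ≤ k ∧ k ≤ K ∧ 1 ≤ i ∧ i + 1 ≤ n k := by
  induction hw with
  | base u i hi hi' =>
    rw [Finset.mem_Icc] at hi hi'
    exact ⟨by omega, le_rfl, hi.1, hi'.2⟩
  | step hw hl h1 ih => exact ⟨ih.1, by omega, ih.2.2⟩

theorem Nbr.gap (h : Admissible n c) {k i K : ℕ} {w w' : Word n K} (hw : Nbr k i w w') :
    leftEnd n c w' = leftEnd n c w + δ K + ε k := by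
  induction hw with
  | base u i hi hi' =>
    rw [leftEnd_snoc, leftEnd_snoc, stride]
    push_cast; ring
  | step hw hl h1 ih => rw [leftEnd_snoc_one, rightEnd_snoc_last h, ih]

/-- No component of level `K` lies between the two neighbours; this is what excludes points of `E`
from the gap. -/
theorem Nbr.le_or_le (h : Admissible n c) {k i K : ℕ} {w w' : Word n K} (hw : Nbr k i w w')
    (v : Word n K) : leftEnd n c v ≤ leftEnd n c w ∨ leftEnd n c w' ≤ leftEnd n c v := by
  induction hw with
  | @base k u i hi hi' =>
    cases v with | snoc v b hb =>
    simp only [leftEnd_snoc]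
    rw [Finset.mem_Icc] at hi hi' hb
    by_cases huv : u = v
    · subst huv
      rcases Nat.lt_or_ge i b with hlt | hge
      · right
        have h1 : ((i + 1 : ℕ) : ℝ) ≤ b := by exact_mod_cast hlt
        have h3 := mul_le_mul_of_nonneg_right h1 (stride_pos h k).le
        linarith
      · left
        have h1 : (b : ℝ) ≤ i := by exact_mod_cast hge
        have h3 := mul_le_mul_of_nonneg_right h1 (stride_pos h k).le
        linarith
    · have a1 := sub_one_mul_stride_nonneg h k hi.1
      have a2 := mul_stride_le h k hi'.2
      have b1 := sub_one_mul_stride_nonneg h k hb.1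
      have b2 := mul_stride_le h k hb.2
      have := compLength_pos h (k + 1)
      rcases separated h huv with h1 | h1
      · right; linarith
      · left; linarith
  | @step k i K w w' hw hl h1 ih =>
    cases v with | snoc v b hb =>
    simp only [leftEnd_snoc]
    rw [Finset.mem_Icc] at hb
    have b1 := sub_one_mul_stride_nonneg h K hb.1
    rcases ih v with h2 | h2
    · left
      have h1 : (b : ℝ) ≤ n (K + 1) := by exact_mod_cast hb.2
      have h3 := mul_le_mul_of_nonneg_right h1 (stride_pos h K).le
      linarith
    · right
      simp only [Nat.cast_one, sub_self, zero_mul, add_zero]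
      linarith

theorem Nbr.le_of_lt (h : Admissible n c) {k i K : ℕ} {w w' : Word n K} (hw : Nbr k i w w')
    {x : ℝ} (hx : x ∈ E) (hlt : x < leftEnd n c w') : x ≤ leftEnd n c w + δ K := by
  obtain ⟨v, hv⟩ := exists_component hx K
  have h1 := hv.1; have h2 := hv.2
  rcases hw.le_or_le h v with h3 | h3 <;> linarith

theorem Nbr.ge_of_gt (h : Admissible n c) {k i K : ℕ} {w w' : Word n K} (hw : Nbr k i w w')
    {x : ℝ} (hx : x ∈ E) (hlt : leftEnd n c w + δ K < x) : leftEnd n c w' ≤ x := by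
  by_contra hcon
  have := hw.le_of_lt h hx (not_le.1 hcon)
  linarith

theorem exists_nbr (h : Admissible n c) {k i K : ℕ} (hk : 1 ≤ k) (hK : k ≤ K) (hi : 1 ≤ i)
    (hi' : i + 1 ≤ n k) : ∃ w w' : Word n K, Nbr k i w w' := by
  induction K, hK using Nat.le_induction with
  | base =>
    obtain ⟨k, rfl⟩ : ∃ j, k = j + 1 := ⟨k - 1, by omega⟩
    obtain ⟨u, -⟩ := exists_leftmost h k
    exact ⟨_, _, .base u i (Finset.mem_Icc.2 ⟨hi, by omega⟩) (Finset.mem_Icc.2 ⟨by omega, hi'⟩)⟩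
  | succ K _ ih =>
    obtain ⟨w, w', hw⟩ := ih
    exact ⟨_, _, hw.step (last_mem h K) (one_mem h K)⟩

/-- Two siblings this close are consecutive. Otherwise the parents are even closer relative to their
length, hence neighbours by induction, and only the outermost children can face each other at
distance below δ_{K+1}. Thus a ball of radius at most δ_K can spill from a component into at most
one neighbour on each side. -/
theorem exists_nbr_of_close (h : Admissible n c) {K : ℕ} (w w' : Word n K)
    (hlt : leftEnd n c w + δ K < leftEnd n c w')
    (hclose : leftEnd n c w' < leftEnd n c w + 2 * δ K) : ∃ k i, Nbr k i w w' := by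
  induction K with
  | zero =>
    cases w; cases w'
    have := compLength_pos h 0
    linarith
  | succ K ih =>
    cases w with | snoc w a ha =>
    cases w' with | snoc w' b hb =>
    simp only [leftEnd_snoc] at hlt hclose
    have hτ := stride_pos h K
    have hδ := compLength_pos h (K + 1)
    have hδτ := compLength_lt_stride h K
    have ha' := Finset.mem_Icc.1 ha
    have hb' := Finset.mem_Icc.1 hb
    by_cases hw : w = w'
    · subst hw
      have h1 : a < b := by
        by_contra hcon
        have h1 : (b : ℝ) ≤ a := by exact_mod_cast not_lt.1 hcon
        have h3 := mul_le_mul_of_nonneg_right h1 hτ.le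
        linarith
      have h2 : b < a + 2 := by
        by_contra hcon
        have h1 : (a : ℝ) + 2 ≤ b := by exact_mod_cast not_lt.1 hcon
        have h3 := mul_le_mul_of_nonneg_right h1 hτ.le
        linarith
      obtain rfl : b = a + 1 := by omega
      exact ⟨_, _, .base w a ha hb⟩
    · have hanti := compLength_strictAnti h (Nat.lt_succ_self K)
      have a1 := sub_one_mul_stride_nonneg h K ha'.1
      have a2 := mul_stride_le h K ha'.2
      have b1 := sub_one_mul_stride_nonneg h K hb'.1
      have b2 := mul_stride_le h K hb'.2
      have hsep : leftEnd n c w + δ K < leftEnd n c w' := by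
        rcases separated h hw with h1 | h1
        · exact h1
        · linarith
      have hK := compLength_eq h K
      have h5 : τ (K + 1) = δ (K + 1) + ε (K + 1) := rfl
      obtain ⟨k, i, hN⟩ := ih w w' hsep (by simp only [Nat.succ_eq_add_one] at hanti; linarith)
      -- A later child starts a full stride, which exceeds δ_{K+1}, after the left end of its
      -- parent.
      have hb1 : b = 1 := by
        by_contra hcon
        have h1 : (2 : ℝ) ≤ b := by exact_mod_cast (show 2 ≤ b by omega)
        have h3 := mul_le_mul_of_nonneg_right h1 hτ.le
        linarith
      have han : a = n (K + 1) := by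
        by_contra hcon
        have h1 : (a : ℝ) + 1 ≤ n (K + 1) := by
          exact_mod_cast (show a + 1 ≤ n (K + 1) by omega)
        have h3 := mul_le_mul_of_nonneg_right h1 hτ.le
        linarith
      subst hb1
      revert ha
      rw [han]
      intro ha
      exact ⟨k, i, hN.step ha hb⟩

/-! ### Uniform vectors in terms of partial sums. -/

/-- `v_1 + ⋯ + v_x`. -/
def prefixSum (v : ℕ → ℝ) (x : ℕ) : ℝ := ∑ a ∈ Finset.Icc 1 x, v a

@[simp] theorem prefixSum_zero (v : ℕ → ℝ) : prefixSum v 0 = 0 := by simp [prefixSum]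

theorem prefixSum_succ (v : ℕ → ℝ) (x : ℕ) : prefixSum v (x + 1) = prefixSum v x + v (x + 1) :=
  Finset.sum_Icc_succ_top (by omega) v

theorem blockSum_eq (v : ℕ → ℝ) (i l : ℕ) :
    blockSum v i l = prefixSum v (i + l) - prefixSum v i := by
  induction l with
  | zero => simp [blockSum]
  | succ l ih =>
    have h1 : blockSum v i (l + 1) = blockSum v i l + v (i + l + 1) := by
      rw [blockSum, ← add_assoc, Finset.sum_Icc_succ_top (by omega)]; rfl
    rw [h1, ih, ← add_assoc, prefixSum_succ]
    ring

theorem prefixSum_lt {N : ℕ} {v : ℕ → ℝ} (hv : ∀ a ∈ Finset.Icc 1 N, 0 < v a) {x y : ℕ}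
    (hxy : x < y) (hy : y ≤ N) : prefixSum v x < prefixSum v y := by
  induction y, hxy using Nat.le_induction with
  | base =>
    have := hv (x + 1) (Finset.mem_Icc.2 ⟨by omega, hy⟩)
    rw [Nat.succ_eq_add_one, prefixSum_succ]; linarith
  | succ y _ ih =>
    have := hv (y + 1) (Finset.mem_Icc.2 ⟨by omega, hy⟩)
    have := ih (by omega)
    rw [prefixSum_succ]; linarith

theorem prefixSum_le {N : ℕ} {v : ℕ → ℝ} (hv : ∀ a ∈ Finset.Icc 1 N, 0 < v a) {x y : ℕ}
    (hxy : x ≤ y) (hy : y ≤ N) : prefixSum v x ≤ prefixSum v y := by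
  rcases hxy.eq_or_lt with rfl | hlt
  · exact le_rfl
  · exact (prefixSum_lt hv hlt hy).le

theorem prefixSum_nonneg {N : ℕ} {v : ℕ → ℝ} (hv : ∀ a ∈ Finset.Icc 1 N, 0 < v a) {x : ℕ}
    (hx : x ≤ N) : 0 ≤ prefixSum v x := by
  simpa using prefixSum_le hv (Nat.zero_le x) hx

/-- Uniformity, without quotients and in terms of the partial sums `S`. -/
def SumUniform (C : ℝ) (s N : ℕ) (S : ℕ → ℝ) : Prop :=
  ∀ i j l : ℕ, s ≤ l → i ≤ j → j ≤ i + l → j + l ≤ N →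
    S (i + l) - S i ≤ C * (S (j + l) - S j) ∧ S (j + l) - S j ≤ C * (S (i + l) - S i)

/-- With `1 ≤ s` every block in question is nonempty and has positive sum, so the quotients can be
cleared. -/
theorem isUniformFrom_iff {C : ℝ} (hC : 0 < C) {s N : ℕ} (hs : 1 ≤ s) {v : ℕ → ℝ}
    (hv : ∀ a ∈ Finset.Icc 1 N, 0 < v a) :
    IsUniformFrom C s N v ↔ SumUniform C s N (prefixSum v) := by
  have key : ∀ i j l : ℕ, s ≤ l → i ≤ j → j + l ≤ N →
      ((C⁻¹ ≤ blockSum v i l / blockSum v j l ∧ blockSum v i l / blockSum v j l ≤ C) ↔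
      (prefixSum v (i + l) - prefixSum v i ≤ C * (prefixSum v (j + l) - prefixSum v j) ∧
        prefixSum v (j + l) - prefixSum v j ≤ C * (prefixSum v (i + l) - prefixSum v i))) := by
    intro i j l h1 h2 h3
    rw [blockSum_eq, blockSum_eq]
    have hj : 0 < prefixSum v (j + l) - prefixSum v j :=
      sub_pos.2 (prefixSum_lt hv (by omega) h3)
    rw [div_le_iff₀ hj, le_div_iff₀ hj, inv_mul_le_iff₀ hC, and_comm]
  constructor
  · intro h i j l h1 h2 h3 h4
    exact (key i j l h1 h2 h4).1 (h i j l h1 (by omega) h2 h3 (by omega) h4)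
  · intro h i j l h1 _ h2 h3 _ h4
    exact (key i j l h1 h2 h4).2 (h i j l h1 h2 h3 h4)

theorem SumUniform.mono {C C' : ℝ} (hCC : C ≤ C') {s N : ℕ} {S : ℕ → ℝ}
    (hS : ∀ x y, x ≤ y → y ≤ N → S x ≤ S y) (h : SumUniform C s N S) : SumUniform C' s N S := by
  intro i j l h1 h2 h3 h4
  have a := h i j l h1 h2 h3 h4
  have b1 := sub_nonneg.2 (hS i (i + l) (by omega) (by omega))
  have b2 := sub_nonneg.2 (hS j (j + l) (by omega) (by omega))
  exact ⟨a.1.trans (mul_le_mul_of_nonneg_right hCC b2),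
    a.2.trans (mul_le_mul_of_nonneg_right hCC b1)⟩

/-- Passing from radius `q` to `2q + 1` adds at most `q + 1` entries on each side. Each added run is
adjacent to a run of equal length inside the smaller window, so it costs at most `C` times that
window. The `min` and the truncated subtraction cut windows at the two ends of the vector. -/
theorem window_le {C : ℝ} (hC : 0 ≤ C) {N : ℕ} {S : ℕ → ℝ}
    (hS : ∀ x y, x ≤ y → y ≤ N → S x ≤ S y) (h : SumUniform C 1 N S) {i : ℕ} (hi : 1 ≤ i)
    (hiN : i ≤ N) (q : ℕ) :
    S (min N (i + (2 * q + 1))) - S (i - 1 - (2 * q + 1)) ≤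
      (1 + 2 * C) * (S (min N (i + q)) - S (i - 1 - q)) := by
  set W := S (min N (i + q)) - S (i - 1 - q) with hW
  have hW0 : 0 ≤ W := sub_nonneg.2 (hS _ _ (by omega) (by omega))
  have hCW := mul_nonneg hC hW0
  have right : S (min N (i + (2 * q + 1))) - S (min N (i + q)) ≤ C * W := by
    rcases Nat.lt_or_ge (i + q) N with h1 | h1
    · obtain ⟨l, hl⟩ : ∃ l, min N (i + (2 * q + 1)) = i + q + l :=
        ⟨min N (i + (2 * q + 1)) - (i + q), by omega⟩
      have h2 := (h (i + q - l) (i + q) l (by omega) (by omega) (by omega) (by omega)).2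
      rw [show i + q - l + l = i + q by omega] at h2
      have h3 := hS (i - 1 - q) (i + q - l) (by omega) (by omega)
      rw [hl, min_eq_right h1.le]
      refine h2.trans (mul_le_mul_of_nonneg_left ?_ hC)
      rw [hW, min_eq_right h1.le]
      linarith
    · rw [min_eq_left h1, min_eq_left (by omega)]; simpa using hCW
  have left : S (i - 1 - q) - S (i - 1 - (2 * q + 1)) ≤ C * W := by
    rcases Nat.eq_zero_or_pos (i - 1 - q) with h1 | h1
    · rw [show i - 1 - (2 * q + 1) = 0 by omega, h1]; simpa using hCW
    · obtain ⟨l, hl⟩ : ∃ l, i - 1 - q = i - 1 - (2 * q + 1) + l :=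
        ⟨i - 1 - q - (i - 1 - (2 * q + 1)), by omega⟩
      have h2 := (h (i - 1 - (2 * q + 1)) (i - 1 - q) l (by omega) (by omega) (by omega)
        (by omega)).1
      rw [← hl] at h2
      refine h2.trans (mul_le_mul_of_nonneg_left ?_ hC)
      have h3 := hS (i - 1 - q + l) (min N (i + q)) (by omega) (by omega)
      linarith
  linarith

theorem prefixSum_dbl_of_le {N : ℕ} (v : ℕ → ℝ) {x : ℕ} (hx : x ≤ N) :
    prefixSum (dbl N v) x = prefixSum v x := by
  refine Finset.sum_congr rfl fun a ha => ?_
  rw [Finset.mem_Icc] at ha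
  rw [dbl, if_pos (by omega)]

theorem prefixSum_dbl_add {N : ℕ} (v : ℕ → ℝ) (x : ℕ) :
    prefixSum (dbl N v) (N + x) = prefixSum v N + prefixSum v x := by
  induction x with
  | zero => simp [prefixSum_dbl_of_le]
  | succ x ih =>
    rw [← add_assoc, prefixSum_succ, ih, prefixSum_succ, dbl, if_neg (by omega),
      show N + x + 1 - N = x + 1 by omega]
    ring

theorem dbl_pos {N : ℕ} {v : ℕ → ℝ} (hv : ∀ a ∈ Finset.Icc 1 N, 0 < v a) :
    ∀ a ∈ Finset.Icc 1 (2 * N), 0 < dbl N v a := by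
  intro a ha
  rw [Finset.mem_Icc] at ha
  unfold dbl
  split_ifs with h
  · exact hv a (Finset.mem_Icc.2 ⟨ha.1, h⟩)
  · exact hv _ (Finset.mem_Icc.2 ⟨by omega, by omega⟩)

/-- A uniform vector whose initial and final sums are comparable from length `s` on has a
uniform double from length `s` on. -/
theorem sumUniform_dbl {C : ℝ} (hC : 1 ≤ C) {s N : ℕ} (hsN : s ≤ N) {v : ℕ → ℝ}
    (hv : ∀ a ∈ Finset.Icc 1 N, 0 < v a) (h : SumUniform C 1 N (prefixSum v))
    (hsym : ∀ l, s ≤ l → l ≤ N →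
      prefixSum v l ≤ C * (prefixSum v N - prefixSum v (N - l)) ∧
      prefixSum v N - prefixSum v (N - l) ≤ C * prefixSum v l) :
    SumUniform ((1 + C) ^ 3) s (2 * N) (prefixSum (dbl N v)) := by
  have hC0 : 0 ≤ C := by linarith
  set S := prefixSum v with hSdef
  set T := prefixSum (dbl N v) with hTdef
  have hS : ∀ x y, x ≤ y → y ≤ N → S x ≤ S y := fun x y => prefixSum_le hv
  have hT : ∀ x y, x ≤ y → y ≤ 2 * N → T x ≤ T y := fun x y => prefixSum_le (dbl_pos hv)
  have hS0 : S 0 = 0 := prefixSum_zero v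
  have hTle : ∀ x, x ≤ N → T x = S x := fun x => prefixSum_dbl_of_le v
  have hTadd : ∀ x, T (N + x) = S N + S x := prefixSum_dbl_add v
  -- The `l ≤ y` added entries are compared with the `l` entries just before them; `final` is the
  -- mirror image.
  have initial : ∀ y, y ≤ N → S (min N (2 * y)) ≤ (1 + C) * S y := by
    intro y hy
    obtain ⟨l, hl⟩ : ∃ l, min N (2 * y) = y + l := ⟨min N (2 * y) - y, by omega⟩
    have h0 : 0 ≤ S y := hS0 ▸ hS 0 y (by omega) hy
    rcases Nat.eq_zero_or_pos l with rfl | hl0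
    · rw [hl]; simp only [add_zero]; nlinarith
    · have h1 := (h (y - l) y l hl0 (by omega) (by omega) (by omega)).2
      rw [show y - l + l = y by omega, ← hl] at h1
      have h2 : 0 ≤ S (y - l) := hS0 ▸ hS 0 (y - l) (by omega) (by omega)
      nlinarith
  have final : ∀ y, y ≤ N → S N - S (N - 2 * y) ≤ (1 + C) * (S N - S (N - y)) := by
    intro y hy
    obtain ⟨l, hl⟩ : ∃ l, N - y = N - 2 * y + l := ⟨N - y - (N - 2 * y), by omega⟩
    have h0 := hS (N - y) N (by omega) le_rfl
    rcases Nat.eq_zero_or_pos l with rfl | hl0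
    · rw [hl]; simp only [add_zero] at hl ⊢; rw [hl] at h0; nlinarith
    · have h1 := (h (N - 2 * y) (N - y) l hl0 (by omega) (by omega) (by omega)).1
      rw [← hl] at h1
      have h2 := hS (N - y + l) N (by omega) le_rfl
      nlinarith
  -- The hypotheses say that the block lies within distance `l` of the junction `N`, so it is
  -- contained in the last `2l` entries of the first copy and the first `2l` of the second.
  have upper : ∀ i l, s ≤ l → N ≤ i + 2 * l → i ≤ N + l → i + l ≤ 2 * N →
      T (i + l) - T i ≤ (1 + C) * (S (min N l) + (S N - S (N - l))) := by
    intro i l h1 h2 h3 h4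
    have a1 := hT (i + l) (N + min N (2 * l)) (by omega) (by omega)
    have a2 := hT (N - 2 * l) i (by omega) (by omega)
    rw [hTadd] at a1
    rw [hTle _ (by omega)] at a2
    have a3 := initial (min N l) (by omega)
    have a4 := final (min N l) (by omega)
    rw [show min N (2 * min N l) = min N (2 * l) by omega] at a3
    rw [show N - 2 * min N l = N - 2 * l by omega, show N - min N l = N - l by omega] at a4
    nlinarith
  -- If the block straddles the junction, its longer part has at least half its length and dominates
  -- the corresponding end sum. A block on one side is compared with the run between it and the
  -- junction.
  have lower : ∀ i l, s ≤ l → N ≤ i + 2 * l → i ≤ N + l → i + l ≤ 2 * N →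
      S (min N l) ≤ (1 + C) * (T (i + l) - T i) ∨
        S N - S (N - l) ≤ (1 + C) * (T (i + l) - T i) := by
    intro i l h1 h2 h3 h4
    rcases Nat.lt_or_ge N (i + l) with h5 | h5
    · rcases Nat.lt_or_ge i N with h6 | h6
      · obtain ⟨b, hb⟩ : ∃ b, i + l = N + b := ⟨i + l - N, by omega⟩
        rw [hb, hTadd, hTle i h6.le]
        have a0 : 0 ≤ S b := hS0 ▸ hS 0 b (by omega) (by omega)
        have a1 := hS i N h6.le le_rfl
        rcases Nat.lt_or_ge (N - i) b with h7 | h7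
        · left
          have a2 := initial b (by omega)
          have a3 := hS (min N l) (min N (2 * b)) (by omega) (by omega)
          nlinarith
        · right
          have a2 := final (N - i) (by omega)
          rw [show N - (N - i) = i by omega] at a2
          have a3 := hS (N - 2 * (N - i)) (N - l) (by omega) (by omega)
          nlinarith
      · left
        obtain ⟨y, rfl⟩ : ∃ y, i = N + y := ⟨i - N, by omega⟩
        rw [add_assoc, hTadd, hTadd]
        have a1 := hS (min N l) (y + l) (by omega) (by omega)
        have a3 := hS y (y + l) (by omega) (by omega)
        rcases Nat.eq_zero_or_pos y with rfl | hy
        · rw [hS0] at *; nlinarith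
        · have a2 := (h 0 y y hy (by omega) (by omega) (by omega)).1
          rw [zero_add, hS0] at a2
          have a4 := hS (y + y) (y + l) (by omega) (by omega)
          nlinarith
    · right
      rw [hTle _ h5, hTle i (by omega)]
      obtain ⟨r, hr⟩ : ∃ r, N = i + l + r := ⟨N - (i + l), by omega⟩
      have a1 := hS i (N - l) (by omega) (by omega)
      have a3 := hS i (i + l) (by omega) (by omega)
      rcases Nat.eq_zero_or_pos r with rfl | hr0
      · have h8 : i + l = N := hr.symm
        rw [h8] at a3 ⊢
        nlinarith
      · have a2 := (h (i + l - r) (i + l) r hr0 (by omega) (by omega) (by omega)).2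
        rw [show i + l - r + r = i + l by omega, ← hr] at a2
        have a4 := hS i (i + l - r) (by omega) (by omega)
        nlinarith
  -- One factor `1 + C` comes from each of `upper`, the comparison of the two end sums, and `lower`.
  have near : ∀ i j l, s ≤ l → N ≤ i + 2 * l → i ≤ N + l → i + l ≤ 2 * N →
      N ≤ j + 2 * l → j ≤ N + l → j + l ≤ 2 * N →
      T (j + l) - T j ≤ (1 + C) ^ 3 * (T (i + l) - T i) := by
    intro i j l h1 h2 h3 h4 h5 h6 h7
    have a1 := upper j l h1 h5 h6 h7
    have a2 := lower i l h1 h2 h3 h4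
    have a3 := hsym (min N l) (by omega) (by omega)
    rw [show N - min N l = N - l by omega] at a3
    have a4 : S (min N l) + (S N - S (N - l)) ≤ (1 + C) * ((1 + C) * (T (i + l) - T i)) := by
      rcases a2 with a2 | a2
      · have : S (min N l) + (S N - S (N - l)) ≤ (1 + C) * S (min N l) := by linarith
        exact this.trans (mul_le_mul_of_nonneg_left a2 (by linarith))
      · have : S (min N l) + (S N - S (N - l)) ≤ (1 + C) * (S N - S (N - l)) := by linarith
        exact this.trans (mul_le_mul_of_nonneg_left a2 (by linarith))
    calc _ ≤ _ := a1
      _ ≤ _ := mul_le_mul_of_nonneg_left a4 (by linarith)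
      _ = _ := by ring
  have hCC : C ≤ (1 + C) ^ 3 := by nlinarith [sq_nonneg C, mul_nonneg hC0 (sq_nonneg C)]
  intro i j l h1 h2 h3 h4
  rcases Nat.eq_zero_or_pos l with rfl | hl
  · simp
  -- Either both blocks lie in one copy of `v`, or overlapping or touching blocks are both within
  -- distance `l` of the junction.
  rcases Nat.lt_or_ge N (j + l) with h5 | h5
  · rcases Nat.lt_or_ge i N with h6 | h6
    · exact ⟨near j i l h1 (by omega) (by omega) (by omega) (by omega) (by omega) (by omega),
        near i j l h1 (by omega) (by omega) (by omega) (by omega) (by omega) (by omega)⟩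
    · obtain ⟨y, rfl⟩ : ∃ y, i = N + y := ⟨i - N, by omega⟩
      obtain ⟨z, rfl⟩ : ∃ z, j = N + z := ⟨j - N, by omega⟩
      have a := (h.mono hCC hS) y z l hl (by omega) (by omega) (by omega)
      rw [add_assoc, add_assoc, hTadd, hTadd, hTadd, hTadd]
      simpa using a
  · have a := (h.mono hCC hS) i j l hl h2 h3 h5
    rw [hTle _ h5, hTle _ (by omega), hTle _ (by omega), hTle _ (by omega)]
    exact a

/-! ### Masses, blocks of children, and balls contained in them. -/

/-- The mass `∏ p_{j, i_j}` of a word. -/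
def mass (P : ℕ → ℕ → ℝ) : {k : ℕ} → Word n k → ℝ
  | _, .nil => 1
  | _, .snoc (k := k) w i _ => P (k + 1) i * mass P w

theorem mass_snoc {k : ℕ} (w : Word n k) (i : ℕ) (hi : i ∈ Finset.Icc 1 (n (k + 1))) :
    mass P (w.snoc i hi) = P (k + 1) i * mass P w := rfl

theorem IsMatching.pos (hP : IsMatching n P) (k : ℕ) :
    ∀ a ∈ Finset.Icc 1 (n (k + 1)), 0 < P (k + 1) a := (hP (k + 1) (by omega)).1

theorem IsMatching.prefixSum_eq_one (hP : IsMatching n P) (k : ℕ) :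
    prefixSum (P (k + 1)) (n (k + 1)) = 1 := (hP (k + 1) (by omega)).2

theorem mass_pos (hP : IsMatching n P) {k : ℕ} (w : Word n k) : 0 < mass P w := by
  induction w with
  | nil => exact one_pos
  | snoc w i hi ih => exact mul_pos (hP.pos _ i hi) ih

/-- The properties of the set function `S ↦ μ_P(S ∩ E)` on which the doubling criterion rests. -/
structure IsMass (n : ℕ → ℕ) (c : ℕ → ℝ) (P : ℕ → ℕ → ℝ) (m : Set ℝ → ℝ) : Prop where
  mono : ∀ {S T : Set ℝ}, S ∩ cantorSet n c ⊆ T → m S ≤ m T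
  union_le : ∀ S T : Set ℝ, m (S ∪ T) ≤ m S + m T
  component : ∀ {k : ℕ} (w : Word n k), m (component n c w) = mass P w
  children : ∀ {k : ℕ} (w : Word n k) (s : Finset ℕ), s ⊆ Finset.Icc 1 (n (k + 1)) →
    m (⋃ a ∈ s, child n c w a) = mass P w * ∑ a ∈ s, P (k + 1) a

/-- The doubling inequality with constant `K`. -/
def DoublingWith (n : ℕ → ℕ) (c : ℕ → ℝ) (m : Set ℝ → ℝ) (K : ℝ) : Prop :=
  ∀ x ∈ cantorSet n c, ∀ r : ℝ, 0 < r → m (Metric.ball x (2 * r)) ≤ K * m (Metric.ball x r)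

/-- The union of the children of `I_w` with numbers `i + 1, …, i + l`. -/
def block (n : ℕ → ℕ) (c : ℕ → ℝ) {k : ℕ} (w : Word n k) (i l : ℕ) : Set ℝ :=
  ⋃ a ∈ Finset.Icc (i + 1) (i + l), child n c w a

theorem IsMass.block (hm : IsMass n c P m) {k : ℕ} (w : Word n k) {i l : ℕ}
    (hil : i + l ≤ n (k + 1)) : m (block n c w i l) =
      mass P w * (prefixSum (P (k + 1)) (i + l) - prefixSum (P (k + 1)) i) := by
  rw [← blockSum_eq]
  exact hm.children w _ (Finset.Icc_subset_Icc (by omega) hil)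

theorem IsMass.empty (hm : IsMass n c P m) : m ∅ = 0 := by
  have := hm.children (.nil : Word n 0) ∅ (by simp)
  simpa using this

theorem IsMass.nonneg (hm : IsMass n c P m) (S : Set ℝ) : 0 ≤ m S := by
  rw [← hm.empty]
  exact hm.mono (by simp)

theorem mem_block {k : ℕ} {w : Word n k} {i l : ℕ} {x : ℝ} :
    x ∈ block n c w i l ↔ ∃ a, i + 1 ≤ a ∧ a ≤ i + l ∧ x ∈ child n c w a := by
  simp [block, and_assoc]

/-- A point of `E` in `I_w` lies in the block of children determined by strict bounds. -/
theorem mem_block_of_bounds (h : Admissible n c) {k : ℕ} {w : Word n k} {x : ℝ} (hx : x ∈ E)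
    (hw : x ∈ component n c w) {i l : ℕ}
    (h1 : leftEnd n c w + (i - 1) * τ (k + 1) + δ (k + 1) < x)
    (h2 : x < leftEnd n c w + (i + l) * τ (k + 1)) : x ∈ block n c w i l := by
  obtain ⟨a, ha, hxa⟩ := exists_child h hx hw
  have hτ := stride_pos h k
  have hx1 := hxa.1
  have hx2 := hxa.2
  refine mem_block.2 ⟨a, ?_, ?_, hxa⟩
  · by_contra hcon
    have h3 : (a : ℝ) ≤ i := by exact_mod_cast (show a ≤ i by omega)
    have := mul_le_mul_of_nonneg_right h3 hτ.le
    linarith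
  · by_contra hcon
    have h3 : (i : ℝ) + l + 1 ≤ a := by exact_mod_cast (show i + l + 1 ≤ a by omega)
    have := mul_le_mul_of_nonneg_right h3 hτ.le
    linarith

theorem block_bounds (h : Admissible n c) {k : ℕ} {w : Word n k} {i l : ℕ} {x : ℝ}
    (hx : x ∈ block n c w i l) : leftEnd n c w + i * τ (k + 1) ≤ x ∧
      x ≤ leftEnd n c w + (i + l - 1) * τ (k + 1) + δ (k + 1) := by
  obtain ⟨a, h1, h2, h3⟩ := mem_block.1 hx
  have hτ := (stride_pos h k).le
  have h4 : (i : ℝ) + 1 ≤ a := by exact_mod_cast h1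
  have h5 : (a : ℝ) ≤ i + l := by exact_mod_cast h2
  have := mul_le_mul_of_nonneg_right h4 hτ
  have := mul_le_mul_of_nonneg_right h5 hτ
  exact ⟨by linarith [h3.1], by linarith [h3.2]⟩

theorem block_subset (h : Admissible n c) {k : ℕ} (w : Word n k) {i l : ℕ}
    (hil : i + l ≤ n (k + 1)) : block n c w i l ⊆ component n c w := by
  intro x hx
  obtain ⟨a, h1, h2, h3⟩ := mem_block.1 hx
  exact child_subset h w (Finset.mem_Icc.2 ⟨by omega, by omega⟩) h3

theorem DoublingWith.iterate {K : ℝ} (hK : 0 ≤ K) (hd : DoublingWith n c m K) {y : ℝ}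
    (hy : y ∈ E) {ρ : ℝ} (hρ : 0 < ρ) (a : ℕ) :
    m (Metric.ball y (2 ^ a * ρ)) ≤ K ^ a * m (Metric.ball y ρ) := by
  induction a with
  | zero => simp
  | succ a ih =>
    have h1 := hd y hy (2 ^ a * ρ) (by positivity)
    rw [← mul_assoc, ← pow_succ'] at h1
    refine h1.trans ?_
    rw [pow_succ', mul_assoc]
    exact mul_le_mul_of_nonneg_left ih hK

/-- Doubling at a point `y` of a set `A` whose `ρ`-ball does not leave `A`. -/
theorem DoublingWith.le {K : ℝ} (hK : 0 ≤ K) (hm : IsMass n c P m) (hd : DoublingWith n c m K)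
    {y : ℝ} (hy : y ∈ E) {ρ : ℝ} (hρ : 0 < ρ) {A B : Set ℝ} (a : ℕ)
    (hA : ∀ x ∈ E, y - ρ < x → x < y + ρ → x ∈ A)
    (hB : ∀ x ∈ E, x ∈ B → y - 2 ^ a * ρ < x ∧ x < y + 2 ^ a * ρ) :
    m B ≤ K ^ a * m A := by
  have h1 : m B ≤ m (Metric.ball y (2 ^ a * ρ)) := by
    refine hm.mono fun x hx => ?_
    rw [Real.ball_eq_Ioo]
    exact hB x hx.2 hx.1
  have h2 : m (Metric.ball y ρ) ≤ m A := by
    refine hm.mono fun x hx => ?_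
    rw [Real.ball_eq_Ioo] at hx
    exact hA x hx.2 hx.1.1 hx.1.2
  exact h1.trans ((hd.iterate hK hy hρ a).trans (mul_le_mul_of_nonneg_left h2 (by positivity)))

theorem leftEnd_child_mem (h : Admissible n c) {k : ℕ} (w : Word n k) {a : ℕ}
    (ha : a ∈ Finset.Icc 1 (n (k + 1))) : leftEnd n c w + ((a : ℝ) - 1) * τ (k + 1) ∈ E :=
  leftEnd_mem_cantorSet h (w.snoc a ha)

/-- A block of at least three children contains a ball of comparable size. -/
theorem exists_ball_subset_block (h : Admissible n c) {k : ℕ} (w : Word n k) {i l : ℕ}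
    (hl : 3 ≤ l) (hil : i + l ≤ n (k + 1)) :
    ∃ y ∈ E, leftEnd n c w + i * τ (k + 1) ≤ y ∧
      y ≤ leftEnd n c w + (i + l - 1) * τ (k + 1) ∧
      ∀ x ∈ E, y - l / 4 * τ (k + 1) < x → x < y + l / 4 * τ (k + 1) → x ∈ block n c w i l := by
  have hτ := stride_pos h k
  -- The centre is the left end of the middle child `i + q + 1`, with `q` children of the block
  -- before it and at least `q` after it. Having l/4 ≤ q is what needs `3 ≤ l`.
  obtain ⟨q, hq1, hq2, hq3⟩ : ∃ q, 1 ≤ q ∧ l ≤ 4 * q ∧ 2 * q + 1 ≤ l :=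
    ⟨(l - 1) / 2, by omega, by omega, by omega⟩
  have hmem := leftEnd_child_mem h w (a := i + q + 1) (Finset.mem_Icc.2 ⟨by omega, by omega⟩)
  push_cast at hmem
  have e2 : (l : ℝ) ≤ 4 * q := by exact_mod_cast hq2
  have e3 : (2 : ℝ) * q + 1 ≤ l := by exact_mod_cast hq3
  have e4 : (i : ℝ) + l ≤ n (k + 1) := by exact_mod_cast hil
  have e0 : (0 : ℝ) ≤ i := by positivity
  have e5 : (0 : ℝ) ≤ q := by positivity
  have f2 := mul_le_mul_of_nonneg_right e2 hτ.le
  have f3 := mul_le_mul_of_nonneg_right e3 hτ.le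
  have f4 := mul_le_mul_of_nonneg_right e4 hτ.le
  have f0 := mul_nonneg e0 hτ.le
  have f5 := mul_nonneg e5 hτ.le
  have hδ := compLength_eq h k
  have hs : τ (k + 1) = δ (k + 1) + ε (k + 1) := rfl
  have hδ' := compLength_pos h (k + 1)
  have hg := gap_pos h k
  refine ⟨_, hmem, by linarith, by linarith, fun x hx h1 h2 => ?_⟩
  exact mem_block_of_bounds h hx ⟨by linarith, by linarith⟩ (by linarith) (by linarith)

theorem component_eq_block (h : Admissible n c) {k : ℕ} (w : Word n k) {x : ℝ} (hx : x ∈ E) :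
    x ∈ component n c w ↔ x ∈ block n c w 0 (n (k + 1)) := by
  constructor
  · intro hw
    obtain ⟨a, ha, hxa⟩ := exists_child h hx hw
    rw [Finset.mem_Icc] at ha
    exact mem_block.2 ⟨a, by omega, by omega, hxa⟩
  · exact fun hw => block_subset h w (by omega) hw

/-- Unless it consists of two far apart children, a component contains a ball of comparable
size. -/
theorem exists_ball_subset_component (h : Admissible n c) {k : ℕ} (w : Word n k)
    (hcase : 3 ≤ n (k + 1) ∨ ε (k + 1) < δ (k + 1)) :
    ∃ y ∈ E, leftEnd n c w ≤ y ∧ y ≤ leftEnd n c w + δ k ∧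
      ∀ x ∈ E, y - δ k / 4 < x → x < y + δ k / 4 → x ∈ component n c w := by
  have hτ := stride_pos h k
  have hδ := compLength_eq h k
  have hs : τ (k + 1) = δ (k + 1) + ε (k + 1) := rfl
  have hδ' := compLength_pos h (k + 1)
  have hg := gap_pos h k
  -- With two children, the left end of the second serves as centre: the room to its right is
  -- δ_{k+1} > δ_k / 3, as the gap is shorter than a child.
  rcases Nat.lt_or_ge (n (k + 1)) 3 with hn | hn
  · have hn2 : n (k + 1) = 2 := by have := two_le h k; omega
    have hsmall : ε (k + 1) < δ (k + 1) := by
      rcases hcase with h1 | h1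
      · omega
      · exact h1
    have hmem := leftEnd_child_mem h w (a := 2) (Finset.mem_Icc.2 ⟨by omega, by omega⟩)
    rw [hn2] at hδ
    push_cast at hmem hδ
    exact ⟨_, hmem, by linarith, by linarith, fun x hx h1 h2 => ⟨by linarith, by linarith⟩⟩
  · obtain ⟨y, hy, h1, h2, h3⟩ := exists_ball_subset_block h w (i := 0) hn (by omega)
    push_cast at h1 h2
    refine ⟨y, hy, by linarith, by linarith, fun x hx h4 h5 => ?_⟩
    exact (component_eq_block h w hx).2 (h3 x hx (by linarith) (by linarith))

/-- Below the level where the addresses part, the left one takes only last digits and the right one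
only first digits. This is the source of the products in (a). -/
theorem Nbr.mass_eq (hP : IsMatching n P) {k i K : ℕ} {w w' : Word n K} (hw : Nbr k i w w') :
    ∃ M : ℝ, 0 < M ∧ mass P w = M * P k i * ∏ j ∈ Finset.Ioc k K, P j (n j) ∧
      mass P w' = M * P k (i + 1) * ∏ j ∈ Finset.Ioc k K, P j 1 := by
  induction hw with
  | base u i hi hi' =>
    refine ⟨mass P u, mass_pos hP u, ?_, ?_⟩ <;>
    · rw [mass_snoc, Finset.Ioc_self, Finset.prod_empty]; ring
  | @step k i K w w' hw hl h1 ih =>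
    obtain ⟨M, hM, e1, e2⟩ := ih
    have hkK := hw.bounds.2.1
    refine ⟨M, hM, ?_, ?_⟩
    · rw [mass_snoc, e1, Finset.prod_Ioc_succ_top (by omega)]; ring
    · rw [mass_snoc, e2, Finset.prod_Ioc_succ_top (by omega)]; ring

/-! ### Necessity: doubling at the endpoints of `E` and at the scale of a gap. -/

section Necessity

variable {K₀ : ℝ}

/-- Centred at 0, the ball of radius `s` strides meets exactly the first `s` children of the
leftmost component, since nothing of `E` lies to the left; the doubled ball contains one more child.
-/
theorem prefixSum_succ_le (h : Admissible n c) (hP : IsMatching n P) (hm : IsMass n c P m)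
    (hK : 0 ≤ K₀) (hd : DoublingWith n c m K₀) (k : ℕ) {s : ℕ} (hs : 1 ≤ s)
    (hsn : s + 1 ≤ n (k + 1)) :
    prefixSum (P (k + 1)) (s + 1) ≤ K₀ * prefixSum (P (k + 1)) s := by
  have hτ := stride_pos h k
  have hδτ := compLength_lt_stride h k
  have hδ := compLength_pos h (k + 1)
  have hδeq := compLength_eq h k
  have hss : τ (k + 1) = δ (k + 1) + ε (k + 1) := rfl
  obtain ⟨w, hw⟩ := exists_leftmost h k
  have hs' : (1 : ℝ) ≤ s := by exact_mod_cast hs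
  have f1 := mul_le_mul_of_nonneg_right hs' hτ.le
  have hsn' : (s : ℝ) + 1 ≤ n (k + 1) := by exact_mod_cast hsn
  have f2 := mul_le_mul_of_nonneg_right hsn' hτ.le
  have key := hd.le hK hm (leftEnd_mem_cantorSet h w) (ρ := s * τ (k + 1)) (by positivity)
    (A := block n c w 0 s) (B := block n c w 0 (s + 1)) 1 ?_ ?_
  · rw [hm.block w (by omega), hm.block w (by omega)] at key
    simp only [zero_add, prefixSum_zero, sub_zero, pow_one] at key
    rw [mul_left_comm] at key
    exact le_of_mul_le_mul_left key (mass_pos hP w)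
  · intro x hx h1 h2
    have h0 := (cantorSet_subset hx).1
    exact mem_block_of_bounds h hx ⟨by linarith, by linarith⟩ (by push_cast; linarith)
      (by push_cast; linarith)
  · intro x hx hxB
    have hb := block_bounds h hxB
    push_cast at hb
    constructor <;> linarith [hb.1, hb.2]

/-- Mirror image of `prefixSum_succ_le`, centred at 1. -/
theorem suffixSum_succ_le (h : Admissible n c) (hP : IsMatching n P) (hm : IsMass n c P m)
    (hK : 0 ≤ K₀) (hd : DoublingWith n c m K₀) (k : ℕ) {s : ℕ} (hs : 1 ≤ s)
    (hsn : s + 1 ≤ n (k + 1)) :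
    1 - prefixSum (P (k + 1)) (n (k + 1) - (s + 1)) ≤
      K₀ * (1 - prefixSum (P (k + 1)) (n (k + 1) - s)) := by
  have hτ := stride_pos h k
  have hδτ := compLength_lt_stride h k
  have hδ := compLength_pos h (k + 1)
  have hδeq := compLength_eq h k
  have hss : τ (k + 1) = δ (k + 1) + ε (k + 1) := rfl
  obtain ⟨w, hw⟩ := exists_rightmost h k
  have hs' : (1 : ℝ) ≤ s := by exact_mod_cast hs
  have f1 := mul_le_mul_of_nonneg_right hs' hτ.le
  have hsn' : (s : ℝ) + 1 ≤ n (k + 1) := by exact_mod_cast hsn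
  have f2 := mul_le_mul_of_nonneg_right hsn' hτ.le
  have key := hd.le hK hm (rightEnd_mem_cantorSet h w) (ρ := s * τ (k + 1)) (by positivity)
    (A := block n c w (n (k + 1) - s) s) (B := block n c w (n (k + 1) - (s + 1)) (s + 1)) 1 ?_ ?_
  · rw [hm.block w (by omega), hm.block w (by omega)] at key
    rw [Nat.sub_add_cancel hsn, Nat.sub_add_cancel (by omega), hP.prefixSum_eq_one, pow_one,
      mul_left_comm] at key
    exact le_of_mul_le_mul_left key (mass_pos hP w)
  · intro x hx h1 h2
    have h0 := (cantorSet_subset hx).2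
    refine mem_block_of_bounds h hx ⟨by linarith, by linarith⟩ ?_ ?_
    · rw [Nat.cast_sub (by omega)]; linarith
    · rw [Nat.cast_sub (by omega)]; linarith
  · intro x hx hxB
    have hb := block_bounds h hxB
    rw [Nat.cast_sub (by omega)] at hb
    push_cast at hb
    constructor <;> linarith [hb.1, hb.2]

/-- A run of s_k children fits into ε_k, which is shorter than the parent of n_{k+m_k} such
children. -/
theorem sIndex_lt (h : Admissible n c) {k : ℕ} (hk : k ∈ Lam n c) :
    sIndex n c k < n (k + mIndex n c k) := by
  obtain ⟨hm1, -, hm3⟩ := isM_mIndex h hk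
  obtain ⟨hs1, hs2, hs3⟩ := isS_sIndex h hk
  obtain ⟨K, hK⟩ : ∃ K, k + mIndex n c k = K + 1 := ⟨k + mIndex n c k - 1, by omega⟩
  rw [hK] at hs2 hs3 hm3 ⊢
  rw [Nat.add_sub_cancel] at hm3
  have hτ := stride_pos h K
  have hδeq := compLength_eq h K
  have hss : τ (K + 1) = δ (K + 1) + ε (K + 1) := rfl
  by_contra hcon
  have h1 : (n (K + 1) : ℝ) ≤ sIndex n c k := by exact_mod_cast not_lt.1 hcon
  have := mul_le_mul_of_nonneg_right h1 hτ.le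
  nlinarith

/-- The two sides of a gap carry comparable masses at the scale of the gap. -/
theorem gap_scale_comparable (h : Admissible n c) (hP : IsMatching n P) (hm : IsMass n c P m)
    (hK : 0 ≤ K₀) (hd : DoublingWith n c m K₀) {k i K : ℕ} {w w' : Word n K} (hw : Nbr k i w w')
    (hε : ε k < δ K) {s : ℕ} (hs : 1 ≤ s) (hsn : s + 1 ≤ n (K + 1))
    (h1 : (s : ℝ) * τ (K + 1) - ε (K + 1) ≤ ε k)
    (h2 : ε k < (s + 1) * τ (K + 1) - ε (K + 1)) :
    mass P w' * prefixSum (P (K + 1)) s ≤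
        K₀ ^ 3 * (mass P w * (1 - prefixSum (P (K + 1)) (n (K + 1) - s))) ∧
      mass P w * (1 - prefixSum (P (K + 1)) (n (K + 1) - s)) ≤
        K₀ ^ 3 * (mass P w' * prefixSum (P (K + 1)) s) := by
  have hτ := stride_pos h K
  have hδτ := compLength_lt_stride h K
  have hδ := compLength_pos h (K + 1)
  have hδeq := compLength_eq h K
  have hss : τ (K + 1) = δ (K + 1) + ε (K + 1) := rfl
  have hs' : (1 : ℝ) ≤ s := by exact_mod_cast hs
  have f1 := mul_le_mul_of_nonneg_right hs' hτ.le
  have hsn' : (s : ℝ) + 1 ≤ n (K + 1) := by exact_mod_cast hsn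
  have f2 := mul_le_mul_of_nonneg_right hsn' hτ.le
  have hgap := hw.gap h
  have hg : 0 < ε k := gapLength_pos h hw.bounds.1
  -- A ball of radius ε_k at an end of the gap stays on its own side, within `s + 1` children; four
  -- times the radius covers `s` children across the gap. The surplus child is removed at the cost
  -- of the third factor `K₀`.
  have k1 := hd.le hK hm (rightEnd_mem_cantorSet h w) (ρ := ε k) hg
    (A := block n c w (n (K + 1) - (s + 1)) (s + 1)) (B := block n c w' 0 s) 2 ?_ ?_
  · have k2 := hd.le hK hm (leftEnd_mem_cantorSet h w') (ρ := ε k) hg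
      (A := block n c w' 0 (s + 1)) (B := block n c w (n (K + 1) - s) s) 2 ?_ ?_
    · rw [hm.block w (by omega), hm.block w' (by omega), Nat.sub_add_cancel (by omega),
        hP.prefixSum_eq_one] at k1 k2
      simp only [zero_add, prefixSum_zero, sub_zero] at k1 k2
      have p1 := prefixSum_succ_le h hP hm hK hd K hs hsn
      have p2 := suffixSum_succ_le h hP hm hK hd K hs hsn
      constructor
      · calc _ ≤ _ := k1
          _ ≤ K₀ ^ 2 * (mass P w * (K₀ * (1 - prefixSum (P (K + 1)) (n (K + 1) - s)))) := by
            gcongr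
            exact (mass_pos hP w).le
          _ = _ := by ring
      · calc _ ≤ _ := k2
          _ ≤ K₀ ^ 2 * (mass P w' * (K₀ * prefixSum (P (K + 1)) s)) := by
            gcongr
            exact (mass_pos hP w').le
          _ = _ := by ring
    · intro x hx g1 g2
      have g3 := hw.ge_of_gt h hx (by linarith)
      exact mem_block_of_bounds h hx ⟨g3, by linarith⟩ (by push_cast; linarith)
        (by push_cast; linarith)
    · intro x hx hxB
      have hb := block_bounds h hxB
      rw [Nat.cast_sub (by omega)] at hb
      constructor <;> linarith [hb.1, hb.2]
  · intro x hx g1 g2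
    have g3 := hw.le_of_lt h hx (by linarith)
    refine mem_block_of_bounds h hx ⟨by linarith, g3⟩ ?_ ?_
    · rw [Nat.cast_sub (by omega)]; push_cast; linarith
    · rw [Nat.cast_sub (by omega)]; push_cast; linarith
  · intro x hx hxB
    have hb := block_bounds h hxB
    push_cast at hb
    constructor <;> linarith [hb.1, hb.2]

end Necessity

/-! ### Necessity: neighbours, runs of siblings, and the two ends of a vector. -/

section Necessity

variable {K₀ : ℝ}

theorem gapLength_lt_of_lt_mIndex (h : Admissible n c) {k K : ℕ} (hk : k ∈ Lam n c)
    (hK : K < k + mIndex n c k) : ε k < δ K :=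
  (isM_mIndex h hk).2.2.trans_le ((compLength_strictAnti h).antitone (by omega))

theorem sIndex_bounds (h : Admissible n c) {k K : ℕ} (hk : k ∈ Lam n c)
    (hK : K + 1 = k + mIndex n c k) :
    1 ≤ sIndex n c k ∧ sIndex n c k + 1 ≤ n (K + 1) ∧
      (sIndex n c k : ℝ) * τ (K + 1) - ε (K + 1) ≤ ε k ∧
      ε k < (sIndex n c k + 1) * τ (K + 1) - ε (K + 1) := by
  obtain ⟨hs1, hs2, hs3⟩ := isS_sIndex h hk
  have hs4 := sIndex_lt h hk
  rw [← hK] at hs2 hs3 hs4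
  have hss : τ (K + 1) = δ (K + 1) + ε (K + 1) := rfl
  rw [hss]
  exact ⟨hs1, hs4, by linarith, by linarith⟩

theorem one_sub_prefixSum_pred (hP : IsMatching n P) (k : ℕ) (hn : 1 ≤ n (k + 1)) :
    1 - prefixSum (P (k + 1)) (n (k + 1) - 1) = P (k + 1) (n (k + 1)) := by
  have h1 := hP.prefixSum_eq_one k
  obtain ⟨N, hN⟩ : ∃ N, n (k + 1) = N + 1 := ⟨n (k + 1) - 1, by omega⟩
  rw [hN, prefixSum_succ] at h1
  rw [hN, Nat.add_sub_cancel]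
  linarith

theorem prefixSum_one (v : ℕ → ℝ) : prefixSum v 1 = v 1 := by simp [prefixSum]

/-- Neighbouring components carry comparable masses as long as they are longer than the gap
between them. -/
theorem nbr_mass_comparable (h : Admissible n c) (hP : IsMatching n P) (hm : IsMass n c P m)
    (hK₀ : 1 ≤ K₀) (hd : DoublingWith n c m K₀) {k i K : ℕ} {w w' : Word n K}
    (hw : Nbr k i w w') (hk : k ∈ Lam n c) (hK : K < k + mIndex n c k) :
    mass P w ≤ K₀ ^ 4 * mass P w' ∧ mass P w' ≤ K₀ ^ 4 * mass P w := by
  have hK0 : 0 ≤ K₀ := by linarith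
  have hε := gapLength_lt_of_lt_mIndex h hk hK
  have hgap := hw.gap h
  have hδK := compLength_pos h K
  have hg : 0 < ε k := gapLength_pos h hw.bounds.1
  by_cases hcase : 3 ≤ n (K + 1) ∨ ε (K + 1) < δ (K + 1)
  · obtain ⟨y, hy, y1, y2, y3⟩ := exists_ball_subset_component h w hcase
    obtain ⟨z, hz, z1, z2, z3⟩ := exists_ball_subset_component h w' hcase
    rw [← hm.component w, ← hm.component w']
    constructor
    · refine hd.le hK0 hm hz (by linarith) 4 z3 fun x _ hx => ?_
      have a1 := hx.1; have a2 := hx.2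
      constructor <;> linarith
    · refine hd.le hK0 hm hy (by linarith) 4 y3 fun x _ hx => ?_
      have a1 := hx.1; have a2 := hx.2
      constructor <;> linarith
  -- Two children separated by a gap at least as long as themselves: there may be no central ball.
  -- The children facing each other across ε_k are compared instead, and `F`, `G` bound the parents
  -- by them.
  · push Not at hcase
    have hn : n (K + 1) = 2 := by have := two_le h K; omega
    have hpow : ∀ a b : ℕ, a ≤ b → K₀ ^ a ≤ K₀ ^ b := fun a b hab => pow_le_pow_right₀ hK₀ hab
    have mw := mass_pos hP w
    have mw' := mass_pos hP w'
    have F := prefixSum_succ_le h hP hm hK0 hd K le_rfl (by omega)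
    have G := suffixSum_succ_le h hP hm hK0 hd K le_rfl (by omega)
    have hone := hP.prefixSum_eq_one K
    have hlast := one_sub_prefixSum_pred hP K (by omega)
    rw [hlast, hn] at G
    rw [hn] at hone hlast
    rw [one_add_one_eq_two, hone, prefixSum_one] at F
    simp only [Nat.reduceAdd, tsub_self, prefixSum_zero, sub_zero] at G
    have p1 := hP.pos K 1 (one_mem h K)
    have p2 := hP.pos K 2 (hn ▸ last_mem h K)
    have main : mass P w * P (K + 1) 2 ≤ K₀ ^ 3 * (mass P w' * P (K + 1) 1) ∧
        mass P w' * P (K + 1) 1 ≤ K₀ ^ 3 * (mass P w * P (K + 1) 2) := by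
      rcases Nat.lt_or_ge (K + 1) (k + mIndex n c k) with hK1 | hK1
      · have hε1 := gapLength_lt_of_lt_mIndex h hk hK1
        have hδ := compLength_pos h (K + 1)
        have hst := hw.step (last_mem h K) (one_mem h K)
        have hgap1 := hst.gap h
        set u := w.snoc (n (K + 1)) (last_mem h K) with hu
        set u' := w'.snoc 1 (one_mem h K) with hu'
        have m1 : mass P u = mass P w * P (K + 1) 2 := by rw [hu, mass_snoc, hn, mul_comm]
        have m2 : mass P u' = mass P w' * P (K + 1) 1 := by rw [hu', mass_snoc, mul_comm]
        have bl : Nbr (K + 1) 1 (w.snoc 1 (one_mem h K))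
            (w.snoc (1 + 1) (by rw [hn]; simp)) := .base w 1 _ _
        have br : Nbr (K + 1) 1 (w'.snoc 1 (one_mem h K))
            (w'.snoc (1 + 1) (by rw [hn]; simp)) := .base w' 1 _ _
        have gl := bl.gap h
        have gr := br.gap h
        have eul : leftEnd n c (w.snoc (1 + 1) (by rw [hn]; simp)) = leftEnd n c u := by
          rw [hu, leftEnd_snoc, leftEnd_snoc, hn]
        rw [← m1, ← m2, ← hm.component u, ← hm.component u']
        have hsq := hpow 2 3 (by omega)
        constructor
        -- The centre is the end of `u'` far from the gap ε_k: a ball of radius δ_{K+1} there is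
        -- stopped by the longer gap ε_{K+1} and does not cross ε_k.
        · refine (hd.le hK0 hm (rightEnd_mem_cantorSet h u') hδ 2 (A := component n c u')
            (fun x hx x1 x2 => ?_) fun x _ hx => ?_).trans
            (mul_le_mul_of_nonneg_right hsq (hm.nonneg _))
          · exact ⟨by linarith, br.le_of_lt h hx (by linarith)⟩
          · have a1 := hx.1; have a2 := hx.2
            constructor <;> linarith
        · refine (hd.le hK0 hm (leftEnd_mem_cantorSet h u) hδ 2 (A := component n c u)
            (fun x hx x1 x2 => ?_) fun x _ hx => ?_).trans
            (mul_le_mul_of_nonneg_right hsq (hm.nonneg _))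
          · have := bl.ge_of_gt h hx (by linarith)
            exact ⟨by linarith, by linarith⟩
          · have a1 := hx.1; have a2 := hx.2
            constructor <;> linarith
      · obtain ⟨s1, s2, s3, s4⟩ := sIndex_bounds h (K := K) hk (by omega)
        -- Forced by 1 ≤ s_k < n_{K+1} = 2.
        have hs : sIndex n c k = 1 := by omega
        rw [hs] at s2 s3 s4
        have g := gap_scale_comparable h hP hm hK0 hd hw hε le_rfl s2 s3 s4
        rw [hn, hlast, prefixSum_one] at g
        exact g.symm
    constructor
    · calc mass P w ≤ mass P w * (K₀ * P (K + 1) 2) := le_mul_of_one_le_right mw.le G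
        _ = K₀ * (mass P w * P (K + 1) 2) := by ring
        _ ≤ K₀ * (K₀ ^ 3 * (mass P w' * 1)) := by
          refine mul_le_mul_of_nonneg_left (main.1.trans ?_) hK0
          gcongr
          have := hone; rw [show 2 = 1 + 1 from rfl, prefixSum_succ, prefixSum_one] at this
          linarith
        _ = _ := by ring
    · calc mass P w' ≤ mass P w' * (K₀ * P (K + 1) 1) := le_mul_of_one_le_right mw'.le F
        _ = K₀ * (mass P w' * P (K + 1) 1) := by ring
        _ ≤ K₀ * (K₀ ^ 3 * (mass P w * 1)) := by
          refine mul_le_mul_of_nonneg_left (main.2.trans ?_) hK0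
          gcongr
          have := hone; rw [show 2 = 1 + 1 from rfl, prefixSum_succ, prefixSum_one] at this
          linarith
        _ = _ := by ring

/-- For levels in Λ, siblings are neighbours of the kind already compared. Otherwise the gap is at
least as long as a child, so a ball of radius ε_{k+1} at a suitable endpoint isolates one child
while its fourfold enlargement covers the next. -/
theorem adjacent_comparable (h : Admissible n c) (hP : IsMatching n P) (hm : IsMass n c P m)
    (hK₀ : 1 ≤ K₀) (hd : DoublingWith n c m K₀) (k : ℕ) {i : ℕ} (hi : 1 ≤ i)
    (hin : i + 1 ≤ n (k + 1)) :
    P (k + 1) i ≤ K₀ ^ 4 * P (k + 1) (i + 1) ∧ P (k + 1) (i + 1) ≤ K₀ ^ 4 * P (k + 1) i := by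
  have hK0 : 0 ≤ K₀ := by linarith
  have hmi : i ∈ Finset.Icc 1 (n (k + 1)) := Finset.mem_Icc.2 ⟨hi, by omega⟩
  have hmi' : i + 1 ∈ Finset.Icc 1 (n (k + 1)) := Finset.mem_Icc.2 ⟨by omega, hin⟩
  by_cases hk : k + 1 ∈ Lam n c
  · obtain ⟨u, -⟩ := exists_leftmost h k
    have := nbr_mass_comparable h hP hm hK₀ hd (.base u i hmi hmi') hk
      (by have := (isM_mIndex h hk).1; omega)
    rw [mass_snoc, mass_snoc, ← mul_assoc, ← mul_assoc] at this
    have hu := mass_pos hP u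
    exact ⟨le_of_mul_le_mul_right this.1 hu, le_of_mul_le_mul_right this.2 hu⟩
  · have hbig : δ (k + 1) ≤ ε (k + 1) := by
      by_contra hcon
      exact hk ⟨by omega, not_le.1 hcon⟩
    have hτ := stride_pos h k
    have hδ := compLength_pos h (k + 1)
    have hss : τ (k + 1) = δ (k + 1) + ε (k + 1) := rfl
    have hg := gap_pos h k
    have hδeq := compLength_eq h k
    have hpow : K₀ ^ 2 ≤ K₀ ^ 4 := pow_le_pow_right₀ hK₀ (by omega)
    have key : ∀ a b : ℕ, ∀ (ha : a ∈ Finset.Icc 1 (n (k + 1)))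
        (hb : b ∈ Finset.Icc 1 (n (k + 1))), a ≤ b + 1 → b ≤ a + 1 →
        P (k + 1) b ≤ K₀ ^ 4 * P (k + 1) a := by
      intro a b ha hb h1 h2
      have h1' : (a : ℝ) ≤ b + 1 := by exact_mod_cast h1
      have h2' : (b : ℝ) ≤ a + 1 := by exact_mod_cast h2
      have f1 := mul_le_mul_of_nonneg_right h1' hτ.le
      have f2 := mul_le_mul_of_nonneg_right h2' hτ.le
      have ha' := Finset.mem_Icc.1 ha
      have a3 := sub_one_mul_stride_nonneg h k ha'.1
      have a4 := mul_stride_le h k ha'.2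
      have fin : ∀ u : Word n k, ∀ y ∈ E, leftEnd n c (u.snoc a ha) ≤ y →
          y ≤ leftEnd n c (u.snoc a ha) + δ (k + 1) →
          (∀ x ∈ E, y - ε (k + 1) < x → x < y + ε (k + 1) → x ∈ component n c (u.snoc a ha)) →
          P (k + 1) b ≤ K₀ ^ 4 * P (k + 1) a := by
        intro u y hy y1 y2 y3
        rw [leftEnd_snoc] at y1 y2
        have e := hd.le hK0 hm hy hg (B := component n c (u.snoc b hb)) 2 y3 (fun x hx hxB => by
          have b1 := hxB.1; have b2 := hxB.2
          rw [leftEnd_snoc] at b1 b2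
          constructor <;> linarith)
        rw [hm.component, hm.component, mass_snoc, mass_snoc, ← mul_assoc] at e
        exact (le_of_mul_le_mul_right e (mass_pos hP u)).trans
          (mul_le_mul_of_nonneg_right hpow (hP.pos k a ha).le)
      -- The ball may leave the parent on one side. For `a > 1` this can only be the right, harmless
      -- in the rightmost component; for `a = 1` the left end of the leftmost component is used.
      rcases Nat.lt_or_ge 1 a with h3 | h3
      · obtain ⟨u, hu⟩ := exists_rightmost h k
        have h4 : (2 : ℝ) ≤ a := by exact_mod_cast h3
        have f3 := mul_le_mul_of_nonneg_right h4 hτ.le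
        refine fin u _ (rightEnd_mem_cantorSet h (u.snoc a ha)) (by linarith) le_rfl
          fun x hx x1 x2 => ?_
        rw [leftEnd_snoc] at x1 x2
        have x3 := (cantorSet_subset hx).2
        obtain ⟨e, he, hxe⟩ := exists_child h hx (w := u) ⟨by linarith, by linarith⟩
        have e1 := hxe.1; have e2 := hxe.2
        obtain rfl : e = a := by
          refine le_antisymm ?_ ?_
          · by_contra hcon
            have h5 : (a : ℝ) + 1 ≤ e := by exact_mod_cast not_le.1 hcon
            have := mul_le_mul_of_nonneg_right h5 hτ.le
            linarith
          · by_contra hcon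
            have h5 : (e : ℝ) + 1 ≤ a := by exact_mod_cast not_le.1 hcon
            have := mul_le_mul_of_nonneg_right h5 hτ.le
            linarith
        exact hxe
      · obtain ⟨u, hu⟩ := exists_leftmost h k
        obtain rfl : a = 1 := by omega
        refine fin u _ (leftEnd_mem_cantorSet h (u.snoc 1 ha)) le_rfl (by linarith)
          fun x hx x1 x2 => ?_
        rw [leftEnd_snoc_one] at x1 x2
        have x3 := (cantorSet_subset hx).1
        have h4 : (2 : ℝ) ≤ n (k + 1) := by exact_mod_cast two_le h k
        have f3 := mul_le_mul_of_nonneg_right h4 hτ.le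
        obtain ⟨e, he, hxe⟩ := exists_child h hx (w := u) ⟨by linarith, by linarith⟩
        have e1 := hxe.1
        have he' := Finset.mem_Icc.1 he
        obtain rfl : e = 1 := by
          by_contra hcon
          have h5 : (2 : ℝ) ≤ e := by exact_mod_cast (show 2 ≤ e by omega)
          have := mul_le_mul_of_nonneg_right h5 hτ.le
          linarith
        exact hxe
    exact ⟨key (i + 1) i hmi' hmi (by omega) (by omega), key i (i + 1) hmi hmi' (by omega)
      (by omega)⟩

/-- Runs of three or more children contain comparable balls. Runs of one or two are compared entry
by entry over at most two adjacent steps, giving the square of `K₀ ^ 4`. -/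
theorem sumUniform_of_doubling (h : Admissible n c) (hP : IsMatching n P) (hm : IsMass n c P m)
    (hK₀ : 1 ≤ K₀) (hd : DoublingWith n c m K₀) (k : ℕ) :
    SumUniform (K₀ ^ 8) 1 (n (k + 1)) (prefixSum (P (k + 1))) := by
  have hK0 : 0 ≤ K₀ := by linarith
  set A := K₀ ^ 4 with hA
  have hA1 : 1 ≤ A := one_le_pow₀ hK₀
  have hA2 : K₀ ^ 8 = A * A := by rw [hA]; ring
  have hAA : A ≤ A * A := le_mul_of_one_le_left (by linarith) hA1
  have near : ∀ a b, 1 ≤ a → 1 ≤ b → a ≤ n (k + 1) → b ≤ n (k + 1) → a ≤ b + 2 → b ≤ a + 2 →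
      P (k + 1) a ≤ A * A * P (k + 1) b := by
    have one : ∀ a b, 1 ≤ a → 1 ≤ b → a ≤ n (k + 1) → b ≤ n (k + 1) → a ≤ b + 1 → b ≤ a + 1 →
        P (k + 1) a ≤ A * P (k + 1) b := by
      intro a b ha hb han hbn h1 h2
      rcases lt_trichotomy a b with h3 | h3 | h3
      · obtain rfl : b = a + 1 := by omega
        exact (adjacent_comparable h hP hm hK₀ hd k ha hbn).1
      · subst h3
        exact le_mul_of_one_le_left (hP.pos k a (Finset.mem_Icc.2 ⟨ha, han⟩)).le hA1
      · obtain rfl : a = b + 1 := by omega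
        exact (adjacent_comparable h hP hm hK₀ hd k hb han).2
    intro a b ha hb han hbn h1 h2
    -- The midpoint of `a` and `b` is at most one step from each.
    obtain ⟨e, e1, e2, e3, e4, e5, e6⟩ : ∃ e, 1 ≤ e ∧ e ≤ n (k + 1) ∧ a ≤ e + 1 ∧ e ≤ a + 1 ∧
        e ≤ b + 1 ∧ b ≤ e + 1 := ⟨(a + b) / 2, by omega, by omega, by omega, by omega, by omega,
          by omega⟩
    calc _ ≤ A * P (k + 1) e := one a e ha e1 han e2 e3 e4
      _ ≤ A * (A * P (k + 1) b) :=
        mul_le_mul_of_nonneg_left (one e b e1 hb e2 hbn e5 e6) (by linarith)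
      _ = _ := by ring
  intro i j l hl hij hji hjl
  rw [hA2]
  rcases Nat.lt_or_ge l 3 with h3 | h3
  · have hl' : l = 1 ∨ l = 2 := by omega
    rcases hl' with rfl | rfl
    · rw [prefixSum_succ, prefixSum_succ, add_sub_cancel_left, add_sub_cancel_left]
      exact ⟨near _ _ (by omega) (by omega) (by omega) (by omega) (by omega) (by omega),
        near _ _ (by omega) (by omega) (by omega) (by omega) (by omega) (by omega)⟩
    · have e : ∀ x, prefixSum (P (k + 1)) (x + 2) - prefixSum (P (k + 1)) x =
          P (k + 1) (x + 1) + P (k + 1) (x + 2) := by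
        intro x
        rw [show x + 2 = x + 1 + 1 from rfl, prefixSum_succ, prefixSum_succ]; ring
      rw [e, e, mul_add, mul_add]
      constructor <;> apply add_le_add <;>
      exact near _ _ (by omega) (by omega) (by omega) (by omega) (by omega) (by omega)
  · obtain ⟨w, -⟩ := exists_leftmost h k
    have hτ := stride_pos h k
    have hδτ := compLength_lt_stride h k
    have hpow : K₀ ^ 3 ≤ A * A := by rw [← hA2]; exact pow_le_pow_right₀ hK₀ (by omega)
    have h0 : (0 : ℝ) < l := by exact_mod_cast hl
    have direct : ∀ a b, a ≤ b + l → b ≤ a + l → a + l ≤ n (k + 1) → b + l ≤ n (k + 1) →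
        prefixSum (P (k + 1)) (a + l) - prefixSum (P (k + 1)) a ≤
          A * A * (prefixSum (P (k + 1)) (b + l) - prefixSum (P (k + 1)) b) := by
      intro a b h1 h2 h4 h5
      obtain ⟨y, hy, y1, y2, y3⟩ := exists_ball_subset_block h w h3 h5
      have h1' : (a : ℝ) ≤ b + l := by exact_mod_cast h1
      have h2' : (b : ℝ) ≤ a + l := by exact_mod_cast h2
      have f1 := mul_le_mul_of_nonneg_right h1' hτ.le
      have f2 := mul_le_mul_of_nonneg_right h2' hτ.le
      have e := hd.le hK0 hm hy (by positivity) (B := block n c w a l) 3 y3 (fun x hx hxB => by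
        have hb := block_bounds h hxB
        constructor <;> nlinarith [hb.1, hb.2])
      rw [hm.block w h4, hm.block w h5, mul_left_comm] at e
      exact (le_of_mul_le_mul_left e (mass_pos hP w)).trans (mul_le_mul_of_nonneg_right hpow
        (sub_nonneg.2 (prefixSum_le (hP.pos k) (by omega) h5)))
    exact ⟨direct i j (by omega) hji (by omega) hjl, direct j i hji (by omega) hjl (by omega)⟩

/-- Across a gap ε_k, the facing runs of `l` children agree up to `K₀ ^ 5` and their parents up to
`K₀ ^ 4`; cancelling the parents leaves the end sums, with exponent 9. -/
theorem ends_comparable (h : Admissible n c) (hP : IsMatching n P) (hm : IsMass n c P m)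
    (hK₀ : 1 ≤ K₀) (hd : DoublingWith n c m K₀) {k K : ℕ} (hk : k ∈ Lam n c) (hkK : k ≤ K)
    (hK : K + 1 ≤ k + mIndex n c k) {l : ℕ} (hl : 1 ≤ l) (hln : l ≤ n (K + 1))
    (hs : K + 1 = k + mIndex n c k → sIndex n c k ≤ l) :
    prefixSum (P (K + 1)) l ≤ K₀ ^ 9 * (1 - prefixSum (P (K + 1)) (n (K + 1) - l)) ∧
      1 - prefixSum (P (K + 1)) (n (K + 1) - l) ≤ K₀ ^ 9 * prefixSum (P (K + 1)) l := by
  have hK0 : 0 ≤ K₀ := by linarith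
  obtain ⟨w, w', hw⟩ := exists_nbr h (i := 1) hk.1 hkK le_rfl (by
    obtain ⟨j, rfl⟩ : ∃ j, k = j + 1 := ⟨k - 1, by have := hk.1; omega⟩
    exact two_le h j)
  have hcomp := nbr_mass_comparable h hP hm hK₀ hd hw hk (by omega)
  have mw := mass_pos hP w
  have mw' := mass_pos hP w'
  have hτ := stride_pos h K
  have hδτ := compLength_lt_stride h K
  have hδ := compLength_pos h (K + 1)
  have hδeq := compLength_eq h K
  have hgp := gap_pos h K
  have hε := gapLength_lt_of_lt_mIndex h hk (show K < k + mIndex n c k by omega)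
  have hgap := hw.gap h
  set F := prefixSum (P (K + 1)) with hF
  set N := n (K + 1) with hN
  have F1 : F N = 1 := hP.prefixSum_eq_one K
  have F0 : 0 ≤ F l := prefixSum_nonneg (hP.pos K) hln
  have G0 : 0 ≤ 1 - F (N - l) := by
    rw [← F1]; exact sub_nonneg.2 (prefixSum_le (hP.pos K) (by omega) le_rfl)
  have hpow : ∀ a, a ≤ 5 → K₀ ^ a ≤ K₀ ^ 5 := fun a hab => pow_le_pow_right₀ hK₀ hab
  have two : ∀ l, l ≤ 2 → 1 ≤ l → 2 ≤ N →
      F 1 ≤ F l ∧ F l ≤ K₀ * F 1 ∧ 1 - F (N - 1) ≤ 1 - F (N - l) ∧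
      1 - F (N - l) ≤ K₀ * (1 - F (N - 1)) := by
    intro l h1 h2 h3
    have a1 := prefixSum_succ_le h hP hm hK0 hd K le_rfl h3
    have a2 := suffixSum_succ_le h hP hm hK0 hd K le_rfl h3
    have a3 : F 1 ≤ F 2 := prefixSum_le (hP.pos K) (by omega) h3
    have a4 : F (N - 2) ≤ F (N - 1) := prefixSum_le (hP.pos K) (by omega) (by omega)
    have hl' : l = 1 ∨ l = 2 := by omega
    rcases hl' with rfl | rfl
    · have b1 : 0 ≤ F 1 := prefixSum_nonneg (hP.pos K) (by omega)
      have b2 : F (N - 1) ≤ F N := prefixSum_le (hP.pos K) (by omega) le_rfl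
      refine ⟨le_rfl, by nlinarith, le_rfl, by nlinarith⟩
    · exact ⟨a3, a1, by linarith, a2⟩
  have h2N : 2 ≤ N := two_le h K
  -- Lengthening the facing runs from one child to two costs one factor `K₀` by doubling at the
  -- endpoints of `E`.
  have extend : ∀ l, l ≤ 2 → 1 ≤ l →
      mass P w' * F 1 ≤ K₀ ^ 4 * (mass P w * (1 - F (N - 1))) ∧
      mass P w * (1 - F (N - 1)) ≤ K₀ ^ 4 * (mass P w' * F 1) →
      mass P w' * F l ≤ K₀ ^ 5 * (mass P w * (1 - F (N - l))) ∧
      mass P w * (1 - F (N - l)) ≤ K₀ ^ 5 * (mass P w' * F l) := by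
    intro l h1 h2 hb
    obtain ⟨t1, t2, t3, t4⟩ := two l h1 h2 h2N
    constructor
    · calc mass P w' * F l ≤ mass P w' * (K₀ * F 1) := by gcongr
        _ = K₀ * (mass P w' * F 1) := by ring
        _ ≤ K₀ * (K₀ ^ 4 * (mass P w * (1 - F (N - 1)))) :=
          mul_le_mul_of_nonneg_left hb.1 hK0
        _ ≤ K₀ * (K₀ ^ 4 * (mass P w * (1 - F (N - l)))) := by gcongr
        _ = _ := by ring
    · calc mass P w * (1 - F (N - l)) ≤ mass P w * (K₀ * (1 - F (N - 1))) := by gcongr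
        _ = K₀ * (mass P w * (1 - F (N - 1))) := by ring
        _ ≤ K₀ * (K₀ ^ 4 * (mass P w' * F 1)) := mul_le_mul_of_nonneg_left hb.2 hK0
        _ ≤ K₀ * (K₀ ^ 4 * (mass P w' * F l)) := by gcongr
        _ = _ := by ring
  have main : mass P w' * F l ≤ K₀ ^ 5 * (mass P w * (1 - F (N - l))) ∧
      mass P w * (1 - F (N - l)) ≤ K₀ ^ 5 * (mass P w' * F l) := by
    have weaken : ∀ {a : ℕ} {x y : ℝ}, a ≤ 5 → 0 ≤ y → x ≤ K₀ ^ a * y → x ≤ K₀ ^ 5 * y :=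
      fun ha hy hx => hx.trans (mul_le_mul_of_nonneg_right (hpow _ ha) hy)
    rcases Nat.lt_or_ge l 3 with h3 | h3
    · rcases hK.lt_or_eq with hlt | heq
      · refine extend l (by omega) hl ?_
        have hst := nbr_mass_comparable h hP hm hK₀ hd
          (hw.step (last_mem h K) (one_mem h K)) hk hlt
        rw [mass_snoc, mass_snoc, mul_comm _ (mass P w), mul_comm _ (mass P w')] at hst
        rw [hF, prefixSum_one, hN, one_sub_prefixSum_pred hP K (by omega)]
        exact hst.symm
      · obtain ⟨s1, s2, s3, s4⟩ := sIndex_bounds h hk heq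
        have g := gap_scale_comparable h hP hm hK0 hd hw hε s1 s2 s3 s4
        rcases (hs heq).eq_or_lt with hsl | hsl
        · rw [hsl] at g
          exact ⟨weaken (by omega) (by positivity) g.1, weaken (by omega) (by positivity) g.2⟩
        · have hs1 : sIndex n c k = 1 := by omega
          rw [hs1] at g
          have b1 : 0 ≤ F 1 := prefixSum_nonneg (hP.pos K) (by omega)
          have b2 : 0 ≤ 1 - F (N - 1) := by
            rw [← F1]; exact sub_nonneg.2 (prefixSum_le (hP.pos K) (by omega) le_rfl)
          have hp : K₀ ^ 3 ≤ K₀ ^ 4 := pow_le_pow_right₀ hK₀ (by omega)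
          exact extend l (by omega) hl
            ⟨g.1.trans (mul_le_mul_of_nonneg_right hp (by positivity)),
              g.2.trans (mul_le_mul_of_nonneg_right hp (by positivity))⟩
    · have hl' : (1 : ℝ) ≤ l := by exact_mod_cast hl
      have hg : 0 < ε k := gapLength_pos h hk.1
      have f0 := mul_le_mul_of_nonneg_right hl' hτ.le
      -- With the gap below `l + 1` strides, the two runs and the gap together span fewer than 4l
      -- strides, which is 16 times the radius of the central ball.
      have hgl : ε k < (l + 1) * τ (K + 1) - ε (K + 1) := by
        rcases hK.lt_or_eq with hlt | heq
        · have := gapLength_lt_of_lt_mIndex h hk hlt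
          have hss : τ (K + 1) = δ (K + 1) + ε (K + 1) := rfl
          linarith
        · obtain ⟨-, -, -, s4⟩ := sIndex_bounds h hk heq
          have h5 : (sIndex n c k : ℝ) ≤ l := by exact_mod_cast hs heq
          have f1 := mul_le_mul_of_nonneg_right h5 hτ.le
          linarith
      obtain ⟨y, hy, y1, y2, y3⟩ := exists_ball_subset_block h w (i := N - l) h3 (by omega)
      obtain ⟨z, hz, z1, z2, z3⟩ := exists_ball_subset_block h w' (i := 0) h3 (by omega)
      rw [Nat.cast_sub hln] at y1 y2
      push_cast at z1 z2
      have k1 := hd.le hK0 hm hy (by positivity) (B := block n c w' 0 l) 4 y3 (fun x hx hxB => by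
        have hb := block_bounds h hxB
        push_cast at hb
        constructor <;> linarith [hb.1, hb.2])
      have k2 := hd.le hK0 hm hz (by positivity) (B := block n c w (N - l) l) 4 z3
        (fun x hx hxB => by
          have hb := block_bounds h hxB
          rw [Nat.cast_sub hln] at hb
          constructor <;> linarith [hb.1, hb.2])
      rw [hm.block w (by omega), hm.block w' (by omega), Nat.sub_add_cancel hln,
        hP.prefixSum_eq_one] at k1 k2
      simp only [zero_add, prefixSum_zero, sub_zero] at k1 k2
      exact ⟨weaken (by omega) (by positivity) k1, weaken (by omega) (by positivity) k2⟩
  constructor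
  · refine le_of_mul_le_mul_left ?_ mw'
    calc mass P w' * F l ≤ _ := main.1
      _ ≤ K₀ ^ 5 * ((K₀ ^ 4 * mass P w') * (1 - F (N - l))) := by gcongr; exact hcomp.1
      _ = _ := by ring
  · refine le_of_mul_le_mul_left ?_ mw
    calc mass P w * (1 - F (N - l)) ≤ _ := main.2
      _ ≤ K₀ ^ 5 * ((K₀ ^ 4 * mass P w) * F l) := by gcongr; exact hcomp.2
      _ = _ := by ring

theorem prod_Ioc_eq (f : ℕ → ℝ) (k t : ℕ) :
    ∏ j ∈ Finset.Ioc k (k + t), f j = ∏ j ∈ Finset.Icc 1 t, f (k + j) := by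
  induction t with
  | zero => simp
  | succ t ih =>
    rw [← add_assoc, Finset.prod_Ioc_succ_top (by omega), ih, Finset.prod_Icc_succ_top (by omega),
      add_assoc]

/-- In the masses of two neighbours the common factor cancels, and the leading entries p_{k,1},
p_{k,2} are comparable; each comparison contributes `K₀ ^ 4`. -/
theorem prod_comparable (h : Admissible n c) (hP : IsMatching n P) (hm : IsMass n c P m)
    (hK₀ : 1 ≤ K₀) (hd : DoublingWith n c m K₀) {k t : ℕ} (hk : k ∈ Lam n c)
    (ht : t < mIndex n c k) :
    ∏ j ∈ Finset.Icc 1 t, P (k + j) 1 ≤ K₀ ^ 8 * ∏ j ∈ Finset.Icc 1 t, P (k + j) (n (k + j)) ∧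
    ∏ j ∈ Finset.Icc 1 t, P (k + j) (n (k + j)) ≤ K₀ ^ 8 * ∏ j ∈ Finset.Icc 1 t, P (k + j) 1 := by
  have hK0 : 0 ≤ K₀ := by linarith
  obtain ⟨k₁, rfl⟩ : ∃ j, k = j + 1 := ⟨k - 1, by have := hk.1; omega⟩
  have h2 := two_le h k₁
  obtain ⟨w, w', hw⟩ := exists_nbr h (i := 1) hk.1 (show k₁ + 1 ≤ k₁ + 1 + t by omega) le_rfl h2
  obtain ⟨c1, c2⟩ := nbr_mass_comparable h hP hm hK₀ hd hw hk (by omega)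
  obtain ⟨M, hM, e1, e2⟩ := hw.mass_eq hP
  rw [prod_Ioc_eq (fun j => P j (n j))] at e1
  rw [prod_Ioc_eq (fun j => P j 1)] at e2
  obtain ⟨a1, a2⟩ := adjacent_comparable h hP hm hK₀ hd k₁ le_rfl h2
  have p1 := hP.pos k₁ 1 (one_mem h k₁)
  have p2 := hP.pos k₁ (1 + 1) (Finset.mem_Icc.2 ⟨by omega, h2⟩)
  have α0 : 0 ≤ ∏ j ∈ Finset.Icc 1 t, P (k₁ + 1 + j) 1 :=
    Finset.prod_nonneg fun j hj => (hP.pos (k₁ + j) 1 (one_mem h _)).le |> fun q => by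
      rwa [show k₁ + 1 + j = k₁ + j + 1 by omega]
  have β0 : 0 ≤ ∏ j ∈ Finset.Icc 1 t, P (k₁ + 1 + j) (n (k₁ + 1 + j)) :=
    Finset.prod_nonneg fun j hj => (hP.pos (k₁ + j) _ (last_mem h _)).le |> fun q => by
      rwa [show k₁ + 1 + j = k₁ + j + 1 by omega]
  set α := ∏ j ∈ Finset.Icc 1 t, P (k₁ + 1 + j) 1
  set β := ∏ j ∈ Finset.Icc 1 t, P (k₁ + 1 + j) (n (k₁ + 1 + j))
  rw [e1, e2] at c1 c2
  constructor
  · refine le_of_mul_le_mul_left ?_ (mul_pos hM p2)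
    calc M * P (k₁ + 1) (1 + 1) * α ≤ _ := c2
      _ ≤ K₀ ^ 4 * (M * (K₀ ^ 4 * P (k₁ + 1) (1 + 1)) * β) := by gcongr
      _ = _ := by ring
  · refine le_of_mul_le_mul_left ?_ (mul_pos hM p1)
    calc M * P (k₁ + 1) 1 * β ≤ _ := c1
      _ ≤ K₀ ^ 4 * (M * (K₀ ^ 4 * P (k₁ + 1) 1) * α) := by gcongr
      _ = _ := by ring

theorem conditions_of_doubling (h : Admissible n c) (hP : IsMatching n P) (hm : IsMass n c P m)
    (hK₀ : 1 ≤ K₀) (hd : DoublingWith n c m K₀) :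
    ∃ C : ℝ, 1 < C ∧ (∀ k : ℕ, 1 ≤ k → IsUniform C (n k) (P k)) ∧
      ∀ k ∈ Lam n c,
        (∀ t : ℕ, 1 ≤ t → t < mIndex n c k →
          IsUniform C (2 * n (k + t)) (dbl (n (k + t)) (P (k + t))) ∧
          C⁻¹ * ∏ j ∈ Finset.Icc 1 t, P (k + j) 1
            ≤ ∏ j ∈ Finset.Icc 1 t, P (k + j) (n (k + j)) ∧
          ∏ j ∈ Finset.Icc 1 t, P (k + j) (n (k + j))
            ≤ C * ∏ j ∈ Finset.Icc 1 t, P (k + j) 1) ∧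
        IsUniformFrom C (sIndex n c k) (2 * n (k + mIndex n c k))
          (dbl (n (k + mIndex n c k)) (P (k + mIndex n c k))) := by
  have hK9 : 1 ≤ K₀ ^ 9 := one_le_pow₀ hK₀
  have h89 : K₀ ^ 8 ≤ K₀ ^ 9 := pow_le_pow_right₀ hK₀ (by omega)
  have h9C : K₀ ^ 9 ≤ (1 + K₀ ^ 9) ^ 3 := by
    calc K₀ ^ 9 ≤ 1 + K₀ ^ 9 := by linarith
      _ ≤ _ := le_self_pow₀ (by linarith) (by omega)
  have hC1 : 1 < (1 + K₀ ^ 9) ^ 3 := one_lt_pow₀ (by linarith) (by omega)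
  -- The constant delivered by `sumUniform_dbl` for inputs with constant `K₀ ^ 9`.
  set C := (1 + K₀ ^ 9) ^ 3 with hC
  have hC0 : 0 < C := by linarith
  have hdbl : ∀ k ∈ Lam n c, ∀ t s, 1 ≤ t → t ≤ mIndex n c k → 1 ≤ s → s ≤ n (k + t) →
      (t = mIndex n c k → sIndex n c k ≤ s) →
      IsUniformFrom C s (2 * n (k + t)) (dbl (n (k + t)) (P (k + t))) := by
    intro k hk t s ht htm hs hsn hst
    obtain ⟨K, hK⟩ : ∃ K, k + t = K + 1 := ⟨k + t - 1, by omega⟩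
    rw [hK] at hsn ⊢
    rw [isUniformFrom_iff hC0 hs (dbl_pos (hP.pos K))]
    refine sumUniform_dbl hK9 hsn (hP.pos K)
      ((sumUniform_of_doubling h hP hm hK₀ hd K).mono h89 fun _ _ => prefixSum_le (hP.pos K))
      fun l hl hln => ?_
    rw [hP.prefixSum_eq_one]
    exact ends_comparable h hP hm hK₀ hd hk (by omega) (by omega) (by omega) hln
      fun e => (hst (by omega)).trans hl
  refine ⟨C, hC1, fun k hk => ?_, fun k hk => ⟨fun t ht htm => ⟨?_, ?_, ?_⟩, ?_⟩⟩
  · obtain ⟨j, rfl⟩ : ∃ j, k = j + 1 := ⟨k - 1, by omega⟩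
    exact (isUniformFrom_iff hC0 le_rfl (hP.pos j)).2
      ((sumUniform_of_doubling h hP hm hK₀ hd j).mono (h89.trans h9C)
        fun _ _ => prefixSum_le (hP.pos j))
  · refine hdbl k hk t 1 ht htm.le le_rfl ?_ (by omega)
    obtain ⟨K, hK⟩ : ∃ K, k + t = K + 1 := ⟨k + t - 1, by omega⟩
    rw [hK]; have := two_le h K; omega
  · rw [inv_mul_le_iff₀ hC0]
    refine (prod_comparable h hP hm hK₀ hd hk htm).1.trans
      (mul_le_mul_of_nonneg_right (h89.trans h9C) (Finset.prod_nonneg fun j hj => ?_))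
    have := hP.pos (k + j - 1) _ (last_mem h _)
    rw [Nat.sub_add_cancel (by rw [Finset.mem_Icc] at hj; omega)] at this
    exact this.le
  · refine (prod_comparable h hP hm hK₀ hd hk htm).2.trans
      (mul_le_mul_of_nonneg_right (h89.trans h9C) (Finset.prod_nonneg fun j hj => ?_))
    have := hP.pos (k + j - 1) _ (one_mem h _)
    rw [Nat.sub_add_cancel (by rw [Finset.mem_Icc] at hj; omega)] at this
    exact this.le
  · exact hdbl k hk _ _ (isM_mIndex h hk).1 le_rfl (isS_sIndex h hk).1 (sIndex_lt h hk).le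
      fun _ => le_rfl

end Necessity

/-! ### Sufficiency: doubling inside a component and across gaps. -/

section Sufficiency

/-- The union of the children of `I_w` whose number differs from `i` by at most `q`. -/
def window (n : ℕ → ℕ) (c : ℕ → ℝ) {k : ℕ} (w : Word n k) (i q : ℕ) : Set ℝ :=
  block n c w (i - 1 - q) (min (n (k + 1)) (i + q) - (i - 1 - q))

theorem IsMass.window (hm : IsMass n c P m) {k : ℕ} (w : Word n k) {i : ℕ}
    (hi : i ∈ Finset.Icc 1 (n (k + 1))) (q : ℕ) : m (window n c w i q) =
      mass P w * (prefixSum (P (k + 1)) (min (n (k + 1)) (i + q)) -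
        prefixSum (P (k + 1)) (i - 1 - q)) := by
  rw [Finset.mem_Icc] at hi
  have e : i - 1 - q + (min (n (k + 1)) (i + q) - (i - 1 - q)) = min (n (k + 1)) (i + q) := by
    omega
  rw [UniformCantor.window, hm.block w (by omega), e]

theorem window_subset (h : Admissible n c) {k : ℕ} {w : Word n k} {i q : ℕ}
    {x z : ℝ} (hx : x ∈ child n c w i) (hz : z ∈ window n c w i q) :
    z ∈ component n c w ∧ x - (q * τ (k + 1) + δ (k + 1)) ≤ z ∧
      z ≤ x + (q * τ (k + 1) + δ (k + 1)) := by
  obtain ⟨a, h1, h2, h3⟩ := mem_block.1 hz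
  have hτ := (stride_pos h k).le
  have h4 : (a : ℝ) ≤ i + q := by exact_mod_cast (show a ≤ i + q by omega)
  have h5 : (i : ℝ) ≤ a + q := by exact_mod_cast (show i ≤ a + q by omega)
  have f1 := mul_le_mul_of_nonneg_right h4 hτ
  have f2 := mul_le_mul_of_nonneg_right h5 hτ
  have b1 := hx.1; have b2 := hx.2; have b3 := h3.1; have b4 := h3.2
  exact ⟨block_subset h w (by omega) hz, by linarith, by linarith⟩

/-- A child whose number differs by more than `q` is at distance at least `(q + 1)` strides minus
one child length. With `window_subset` this sandwiches balls between windows. -/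
theorem mem_window (h : Admissible n c) {k : ℕ} {w : Word n k} {i q : ℕ} {x z : ℝ}
    (hx : x ∈ child n c w i) (hz : z ∈ E) (hzw : z ∈ component n c w)
    (h1 : x - ((q + 1) * τ (k + 1) - δ (k + 1)) < z)
    (h2 : z < x + ((q + 1) * τ (k + 1) - δ (k + 1))) : z ∈ window n c w i q := by
  obtain ⟨a, ha, hza⟩ := exists_child h hz hzw
  rw [Finset.mem_Icc] at ha
  have hτ := (stride_pos h k).le
  have b1 := hx.1; have b2 := hx.2; have b3 := hza.1; have b4 := hza.2
  have h3 : a ≤ i + q := by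
    by_contra hcon
    have h4 : (i : ℝ) + q + 1 ≤ a := by exact_mod_cast not_le.1 hcon
    have f1 := mul_le_mul_of_nonneg_right h4 hτ
    linarith
  have h5 : i ≤ a + q := by
    by_contra hcon
    have h4 : (a : ℝ) + q + 1 ≤ i := by exact_mod_cast not_le.1 hcon
    have f1 := mul_le_mul_of_nonneg_right h4 hτ
    linarith
  exact mem_block.2 ⟨a, by omega, by omega, hza⟩

variable {A : ℝ}

/-- The radius `8q + 7` is the third iterate of `q ↦ 2q + 1`, so `window_le` is applied three times.
-/
theorem window_doubling (hP : IsMatching n P) (hm : IsMass n c P m) (hA : 1 ≤ A)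
    (hU : ∀ k, SumUniform A 1 (n (k + 1)) (prefixSum (P (k + 1)))) {k : ℕ} (w : Word n k) {i : ℕ}
    (hi : i ∈ Finset.Icc 1 (n (k + 1))) (q : ℕ) :
    m (window n c w i (8 * q + 7)) ≤ (1 + 2 * A) ^ 3 * m (window n c w i q) := by
  have step : ∀ q, m (window n c w i (2 * q + 1)) ≤ (1 + 2 * A) * m (window n c w i q) := by
    intro q
    rw [hm.window w hi, hm.window w hi, mul_left_comm]
    rw [Finset.mem_Icc] at hi
    exact mul_le_mul_of_nonneg_left (window_le (by linarith)
      (fun _ _ => prefixSum_le (hP.pos k)) (hU k) hi.1 hi.2 q) (mass_pos hP w).le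
  have hA0 : 0 ≤ 1 + 2 * A := by linarith
  calc m (window n c w i (8 * q + 7)) = m (window n c w i (2 * (2 * (2 * q + 1) + 1) + 1)) := by
        congr 2; ring
    _ ≤ (1 + 2 * A) * ((1 + 2 * A) * ((1 + 2 * A) * m (window n c w i q))) :=
      (step _).trans (mul_le_mul_of_nonneg_left ((step _).trans
        (mul_le_mul_of_nonneg_left (step _) hA0)) hA0)
    _ = _ := by ring

theorem doubling_inside_of_lt (h : Admissible n c) (hP : IsMatching n P) (hm : IsMass n c P m)
    (hA : 1 ≤ A) (hU : ∀ k, SumUniform A 1 (n (k + 1)) (prefixSum (P (k + 1)))) {k : ℕ}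
    (w : Word n k) {x : ℝ} (hx : x ∈ E) (hxw : x ∈ component n c w) {r : ℝ}
    (hr : δ (k + 1) < r) :
    m (Metric.ball x (2 * r) ∩ component n c w) ≤
      (1 + 2 * A) ^ 3 * m (Metric.ball x r ∩ component n c w) := by
  obtain ⟨i, hi, hxi⟩ := exists_child h hx hxw
  have hτ := stride_pos h k
  have hδτ := compLength_lt_stride h k
  have hδ := compLength_pos h (k + 1)
  -- The largest window guaranteed to lie in the ball of radius `r`; the ball of radius 2r then
  -- stays within window radius `8q + 7`.
  obtain ⟨q, hq1, hq2⟩ : ∃ q : ℕ, q * τ (k + 1) + δ (k + 1) < r ∧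
      r ≤ (q + 1) * τ (k + 1) + δ (k + 1) := by
    have hz : 0 < (r - δ (k + 1)) / τ (k + 1) := div_pos (by linarith) hτ
    have h1 := Nat.ceil_pos.2 hz
    have h2 := Nat.ceil_lt_add_one hz.le
    have h3 := Nat.le_ceil ((r - δ (k + 1)) / τ (k + 1))
    obtain ⟨q, hq⟩ : ∃ q, ⌈(r - δ (k + 1)) / τ (k + 1)⌉₊ = q + 1 :=
      Nat.exists_eq_add_one.2 h1
    rw [hq] at h2 h3
    push_cast at h2 h3
    rw [div_le_iff₀ hτ] at h3
    have h4 : (q : ℝ) < (r - δ (k + 1)) / τ (k + 1) := by linarith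
    rw [lt_div_iff₀ hτ] at h4
    exact ⟨q, by linarith, by linarith⟩
  have hq0 : 0 ≤ (q : ℝ) * τ (k + 1) := by positivity
  refine le_trans (hm.mono fun z hz => ?_) ((window_doubling hP hm hA hU w hi q).trans
    (mul_le_mul_of_nonneg_left (hm.mono fun z hz => ?_) (pow_nonneg (by linarith) 3)))
  · obtain ⟨⟨hzb, hzw⟩, hzE⟩ := hz
    rw [Real.ball_eq_Ioo] at hzb
    have b1 := hzb.1; have b2 := hzb.2
    exact mem_window h hxi hzE hzw (by push_cast; linarith) (by push_cast; linarith)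
  · obtain ⟨b1, b2, b3⟩ := window_subset h hxi hz.1
    refine ⟨?_, b1⟩
    rw [Real.ball_eq_Ioo]
    exact ⟨by linarith, by linarith⟩

/-- If `r` is at most δ_{k+1}, the ball of radius 2r still contains the child around `x`. Window
doubling reduces to that child, and one level down `r` exceeds δ_{k+2}, because lengths at least
halve. -/
theorem doubling_inside (h : Admissible n c) (hP : IsMatching n P) (hm : IsMass n c P m)
    (hA : 1 ≤ A) (hU : ∀ k, SumUniform A 1 (n (k + 1)) (prefixSum (P (k + 1)))) {k : ℕ}
    (w : Word n k) {x : ℝ} (hx : x ∈ E) (hxw : x ∈ component n c w) {r : ℝ}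
    (hr : δ (k + 1) < 2 * r) :
    m (Metric.ball x (2 * r) ∩ component n c w) ≤
      (1 + 2 * A) ^ 6 * m (Metric.ball x r ∩ component n c w) := by
  have hB : 1 ≤ (1 + 2 * A) ^ 3 := one_le_pow₀ (by linarith)
  have hB2 : (1 + 2 * A) ^ 6 = (1 + 2 * A) ^ 3 * (1 + 2 * A) ^ 3 := by ring
  rcases lt_or_ge (δ (k + 1)) r with hlt | hge
  · refine (doubling_inside_of_lt h hP hm hA hU w hx hxw hlt).trans
      (mul_le_mul_of_nonneg_right ?_ (hm.nonneg _))
    rw [hB2]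
    exact le_mul_of_one_le_left (by linarith) hB
  · obtain ⟨i, hi, hxi⟩ := exists_child h hx hxw
    have hτ := stride_pos h k
    have hδτ := compLength_lt_stride h k
    have hδ := compLength_pos h (k + 1)
    have hhalf := compLength_succ_le h (k + 1)
    have hin := doubling_inside_of_lt h hP hm hA hU (w.snoc i hi) hx hxi
      (r := r) (by linarith)
    calc m (Metric.ball x (2 * r) ∩ component n c w)
        ≤ m (window n c w i (8 * 0 + 7)) := by
          refine hm.mono fun z hz => ?_
          obtain ⟨⟨hzb, hzw⟩, hzE⟩ := hz
          rw [Real.ball_eq_Ioo] at hzb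
          have b1 := hzb.1; have b2 := hzb.2
          exact mem_window h hxi hzE hzw (by push_cast; linarith) (by push_cast; linarith)
      _ ≤ (1 + 2 * A) ^ 3 * m (window n c w i 0) := window_doubling hP hm hA hU w hi 0
      _ ≤ (1 + 2 * A) ^ 3 * m (Metric.ball x (2 * r) ∩ component n c (w.snoc i hi)) := by
          refine mul_le_mul_of_nonneg_left (hm.mono fun z hz => ?_) (by linarith)
          have hzc : z ∈ child n c w i := by
            obtain ⟨a, h1, h2, h3⟩ := mem_block.1 hz.1
            rw [Finset.mem_Icc] at hi
            obtain rfl : a = i := by omega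
            exact h3
          refine ⟨?_, hzc⟩
          rw [Real.ball_eq_Ioo]
          have b1 := hxi.1; have b2 := hxi.2; have b3 := hzc.1; have b4 := hzc.2
          exact ⟨by linarith, by linarith⟩
      _ ≤ (1 + 2 * A) ^ 3 *
          ((1 + 2 * A) ^ 3 * m (Metric.ball x r ∩ component n c (w.snoc i hi))) :=
        mul_le_mul_of_nonneg_left hin (by linarith)
      _ ≤ (1 + 2 * A) ^ 3 * ((1 + 2 * A) ^ 3 * m (Metric.ball x r ∩ component n c w)) := by
          have : m (Metric.ball x r ∩ component n c (w.snoc i hi)) ≤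
              m (Metric.ball x r ∩ component n c w) :=
            hm.mono fun z hz => ⟨hz.1.1, child_subset h w hi hz.1.2⟩
          gcongr
      _ = _ := by ring

theorem doubling_inside_twice (h : Admissible n c) (hP : IsMatching n P) (hm : IsMass n c P m)
    (hA : 1 ≤ A) (hU : ∀ k, SumUniform A 1 (n (k + 1)) (prefixSum (P (k + 1)))) {k : ℕ}
    (w : Word n k) {x : ℝ} (hx : x ∈ E) (hxw : x ∈ component n c w) {r : ℝ}
    (hr : δ (k + 1) < 2 * r) :
    m (Metric.ball x (4 * r) ∩ component n c w) ≤
      (1 + 2 * A) ^ 12 * m (Metric.ball x r ∩ component n c w) := by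
  have hδ := compLength_pos h (k + 1)
  have h1 := doubling_inside h hP hm hA hU w hx hxw hr
  have h2 := doubling_inside h hP hm hA hU w hx hxw (r := 2 * r) (by linarith)
  rw [show 2 * (2 * r) = 4 * r by ring] at h2
  calc _ ≤ _ := h2
    _ ≤ (1 + 2 * A) ^ 6 * ((1 + 2 * A) ^ 6 * m (Metric.ball x r ∩ component n c w)) :=
      mul_le_mul_of_nonneg_left h1 (pow_nonneg (by linarith) 6)
    _ = _ := by ring

/-- Comparability of the masses on the two sides of a gap `ε_k`, at all levels at which the
components are longer than the gap. -/
structure GapComparable (n : ℕ → ℕ) (c : ℕ → ℝ) (P : ℕ → ℕ → ℝ) (A : ℝ) : Prop where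
  nbr : ∀ {k i K : ℕ} {w w' : Word n K}, k ∈ Lam n c → Nbr k i w w' → K < k + mIndex n c k →
    mass P w ≤ A * mass P w' ∧ mass P w' ≤ A * mass P w
  ends : ∀ {k K l : ℕ}, k ∈ Lam n c → k ≤ K → K + 1 ≤ k + mIndex n c k → 1 ≤ l →
    l ≤ n (K + 1) → (K + 1 = k + mIndex n c k → sIndex n c k ≤ l) →
    prefixSum (P (K + 1)) l ≤ A * (1 - prefixSum (P (K + 1)) (n (K + 1) - l)) ∧
      1 - prefixSum (P (K + 1)) (n (K + 1) - l) ≤ A * prefixSum (P (K + 1)) l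

/-- Enough children to cover length 2r, facing each other across the gap, carry comparable masses.
The bounds ε_k < 2r ≤ δ_K place `k` in Λ and `K` below k + m_k, the range where the hypotheses
apply. -/
theorem GapComparable.exists_length (h : Admissible n c) (hP : IsMatching n P)
    (hA : 1 ≤ A) (hG : GapComparable n c P A) {k i K : ℕ} {w w' : Word n K} (hw : Nbr k i w w')
    {r : ℝ} (hr : 0 < r) (hrK : 2 * r ≤ δ K) (hε : ε k < 2 * r) :
    ∃ l : ℕ, 1 ≤ l ∧ l ≤ n (K + 1) ∧ ((l : ℝ) - 1) * τ (K + 1) < 2 * r ∧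
      2 * r ≤ l * τ (K + 1) ∧
      mass P w' * prefixSum (P (K + 1)) l ≤
        A ^ 2 * (mass P w * (1 - prefixSum (P (K + 1)) (n (K + 1) - l))) ∧
      mass P w * (1 - prefixSum (P (K + 1)) (n (K + 1) - l)) ≤
        A ^ 2 * (mass P w' * prefixSum (P (K + 1)) l) := by
  have hτ := stride_pos h K
  have hδ := compLength_pos h (K + 1)
  have hδeq := compLength_eq h K
  have hgp := gap_pos h K
  have hb := hw.bounds
  have hanti := (compLength_strictAnti h).antitone
  have hk : k ∈ Lam n c := ⟨hb.1, by have := hanti hb.2.1; linarith⟩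
  have hKm : K < k + mIndex n c k := by
    by_contra hcon
    have h1 := hanti (not_lt.1 hcon)
    have h2 := (isM_mIndex h hk).2.1
    linarith
  have hz : 0 < 2 * r / τ (K + 1) := by positivity
  have c1 := Nat.ceil_pos.2 hz
  have c2 := Nat.ceil_lt_add_one hz.le
  have c3 := Nat.le_ceil (2 * r / τ (K + 1))
  set l₀ := ⌈2 * r / τ (K + 1)⌉₊ with hl₀
  rw [div_le_iff₀ hτ] at c3
  have c4 : ((l₀ : ℝ) - 1) * τ (K + 1) < 2 * r := by rw [← lt_div_iff₀ hτ]; linarith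
  have c5 : l₀ ≤ n (K + 1) := by
    by_contra hcon
    have h1 : (n (K + 1) : ℝ) + 1 ≤ l₀ := by exact_mod_cast not_le.1 hcon
    have := mul_le_mul_of_nonneg_right h1 hτ.le
    linarith
  obtain ⟨l, l1, l2, l3, l4, l5⟩ : ∃ l : ℕ, 1 ≤ l ∧ l ≤ n (K + 1) ∧
      ((l : ℝ) - 1) * τ (K + 1) < 2 * r ∧ 2 * r ≤ l * τ (K + 1) ∧
      (K + 1 = k + mIndex n c k → sIndex n c k ≤ l) := by
    -- At the last level the minimal covering number may be below s_k and is raised to it. A run of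
    -- s_k children fits into ε_k < 2r, so the upper bound on the length survives.
    by_cases hcase : K + 1 = k + mIndex n c k ∧ l₀ < sIndex n c k
    · obtain ⟨s1, s2, s3, s4⟩ := sIndex_bounds h hk hcase.1
      have h1 : (l₀ : ℝ) ≤ sIndex n c k := by exact_mod_cast hcase.2.le
      have := mul_le_mul_of_nonneg_right h1 hτ.le
      have hss : τ (K + 1) = δ (K + 1) + ε (K + 1) := rfl
      exact ⟨sIndex n c k, s1, by omega, by linarith, by linarith, fun _ => le_rfl⟩
    · exact ⟨l₀, c1, c5, c4, c3, fun e => by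
        by_contra hcon
        exact hcase ⟨e, not_le.1 hcon⟩⟩
  obtain ⟨n1, n2⟩ := hG.nbr hk hw hKm
  obtain ⟨e1, e2⟩ := hG.ends hk hb.2.1 hKm l1 l2 l5
  have F0 : 0 ≤ prefixSum (P (K + 1)) l := prefixSum_nonneg (hP.pos K) l2
  have G0 : 0 ≤ 1 - prefixSum (P (K + 1)) (n (K + 1) - l) := by
    rw [← hP.prefixSum_eq_one K]
    exact sub_nonneg.2 (prefixSum_le (hP.pos K) (by omega) le_rfl)
  have mw := (mass_pos hP w).le
  have mw' := (mass_pos hP w').le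
  refine ⟨l, l1, l2, l3, l4, ?_, ?_⟩
  · calc _ ≤ (A * mass P w) * (A * (1 - prefixSum (P (K + 1)) (n (K + 1) - l))) := by
          gcongr
      _ = _ := by ring
  · calc _ ≤ (A * mass P w') * (A * prefixSum (P (K + 1)) l) := by gcongr
      _ = _ := by ring

/-- The spill beyond the right end lies in the first `l` children of one neighbour. Their mass is
controlled by the last `l` children of the component, whose total length is below 2r + δ_{K+1} < 4r,
so they lie in the ball of radius 4r. -/
theorem ball_inter_right_le (h : Admissible n c) (hP : IsMatching n P) (hm : IsMass n c P m)
    (hA : 1 ≤ A) (hG : GapComparable n c P A) {K : ℕ} (w : Word n K) {x : ℝ}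
    (hxw : x ∈ component n c w) {r : ℝ} (hr : δ (K + 1) < 2 * r) (hrK : 2 * r ≤ δ K) :
    m (Metric.ball x (2 * r) ∩ Set.Ioi (leftEnd n c w + δ K)) ≤
      A ^ 2 * m (Metric.ball x (4 * r) ∩ component n c w) := by
  have hA2 : 0 ≤ A ^ 2 := sq_nonneg A
  have hτ := stride_pos h K
  have hδ := compLength_pos h (K + 1)
  have hδeq := compLength_eq h K
  have hss : τ (K + 1) = δ (K + 1) + ε (K + 1) := rfl
  have x1 := hxw.1; have x2 := hxw.2
  by_cases hex : ∃ z ∈ E, leftEnd n c w + δ K < z ∧ z < x + 2 * r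
  · obtain ⟨z, hz, z1, z2⟩ := hex
    obtain ⟨w', hzw'⟩ := exists_component hz K
    have z3 := hzw'.1; have z4 := hzw'.2
    have hne : w ≠ w' := by
      rintro rfl
      linarith
    have hsep : leftEnd n c w + δ K < leftEnd n c w' := by
      rcases separated h hne with h1 | h1
      · exact h1
      · linarith [compLength_pos h K]
    obtain ⟨k, i, hw⟩ := exists_nbr_of_close h w w' hsep (by linarith)
    have hgap := hw.gap h
    have hgk : 0 < ε k := gapLength_pos h hw.bounds.1
    obtain ⟨l, l1, l2, l3, l4, l5, l6⟩ :=
      hG.exists_length h hP hA hw (r := r) (by linarith) hrK (by linarith)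
    calc _ ≤ m (block n c w' 0 l) := by
          refine hm.mono fun y hy => ?_
          obtain ⟨⟨hyb, hy1⟩, hyE⟩ := hy
          rw [Real.ball_eq_Ioo] at hyb
          have y2 := hyb.2
          have y3 := hw.ge_of_gt h hyE hy1
          have hgp := compLength_lt_stride h K
          exact mem_block_of_bounds h hyE ⟨y3, by linarith⟩ (by push_cast; linarith)
            (by push_cast; linarith)
      _ ≤ A ^ 2 * m (block n c w (n (K + 1) - l) l) := by
          rw [hm.block w (by omega), hm.block w' (by omega), Nat.sub_add_cancel l2,
            hP.prefixSum_eq_one]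
          simpa using l5
      _ ≤ _ := by
          refine mul_le_mul_of_nonneg_left (hm.mono fun y hy => ?_) hA2
          have hb := block_bounds h hy.1
          rw [Nat.cast_sub l2] at hb
          have hyw := block_subset h w (by omega) hy.1
          have y1 := hyw.2
          refine ⟨?_, hyw⟩
          rw [Real.ball_eq_Ioo]
          exact ⟨by linarith [hb.1], by linarith⟩
  · calc _ ≤ m ∅ := by
          refine hm.mono fun y hy => hex ⟨y, hy.2, hy.1.2, ?_⟩
          have := hy.1.1
          rw [Real.ball_eq_Ioo] at this
          exact this.2
      _ = 0 := hm.empty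
      _ ≤ _ := mul_nonneg hA2 (hm.nonneg _)

/-- Mirror image of `ball_inter_right_le`. -/
theorem ball_inter_left_le (h : Admissible n c) (hP : IsMatching n P) (hm : IsMass n c P m)
    (hA : 1 ≤ A) (hG : GapComparable n c P A) {K : ℕ} (w : Word n K) {x : ℝ}
    (hxw : x ∈ component n c w) {r : ℝ} (hr : δ (K + 1) < 2 * r) (hrK : 2 * r ≤ δ K) :
    m (Metric.ball x (2 * r) ∩ Set.Iio (leftEnd n c w)) ≤
      A ^ 2 * m (Metric.ball x (4 * r) ∩ component n c w) := by
  have hA2 : 0 ≤ A ^ 2 := sq_nonneg A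
  have hτ := stride_pos h K
  have hδ := compLength_pos h (K + 1)
  have hδeq := compLength_eq h K
  have hss : τ (K + 1) = δ (K + 1) + ε (K + 1) := rfl
  have x1 := hxw.1; have x2 := hxw.2
  by_cases hex : ∃ z ∈ E, z < leftEnd n c w ∧ x - 2 * r < z
  · obtain ⟨z, hz, z1, z2⟩ := hex
    obtain ⟨w', hzw'⟩ := exists_component hz K
    have z3 := hzw'.1; have z4 := hzw'.2
    have hne : w' ≠ w := by
      rintro rfl
      linarith
    have hsep : leftEnd n c w' + δ K < leftEnd n c w := by
      rcases separated h hne with h1 | h1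
      · exact h1
      · linarith [compLength_pos h K]
    obtain ⟨k, i, hw⟩ := exists_nbr_of_close h w' w hsep (by linarith)
    have hgap := hw.gap h
    have hgk : 0 < ε k := gapLength_pos h hw.bounds.1
    obtain ⟨l, l1, l2, l3, l4, l5, l6⟩ :=
      hG.exists_length h hP hA hw (r := r) (by linarith) hrK (by linarith)
    calc _ ≤ m (block n c w' (n (K + 1) - l) l) := by
          refine hm.mono fun y hy => ?_
          obtain ⟨⟨hyb, hy1⟩, hyE⟩ := hy
          rw [Real.ball_eq_Ioo] at hyb
          have y2 := hyb.1
          have y3 := hw.le_of_lt h hyE hy1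
          have hgp := compLength_lt_stride h K
          have hgp' := gap_pos h K
          refine mem_block_of_bounds h hyE ⟨by linarith, y3⟩ ?_ ?_
          · rw [Nat.cast_sub l2]; linarith
          · rw [Nat.cast_sub l2]; linarith
      _ ≤ A ^ 2 * m (block n c w 0 l) := by
          rw [hm.block w (by omega), hm.block w' (by omega), Nat.sub_add_cancel l2,
            hP.prefixSum_eq_one]
          simpa using l6
      _ ≤ _ := by
          refine mul_le_mul_of_nonneg_left (hm.mono fun y hy => ?_) hA2
          have hb := block_bounds h hy.1
          push_cast at hb
          have hyw := block_subset h w (by omega) hy.1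
          have y1 := hyw.1
          refine ⟨?_, hyw⟩
          rw [Real.ball_eq_Ioo]
          exact ⟨by linarith, by linarith [hb.2]⟩
  · calc _ ≤ m ∅ := by
          refine hm.mono fun y hy => hex ⟨y, hy.2, hy.1.2, ?_⟩
          have := hy.1.1
          rw [Real.ball_eq_Ioo] at this
          exact this.1
      _ = 0 := hm.empty
      _ ≤ _ := mul_nonneg hA2 (hm.nonneg _)

theorem exists_compLength_lt (h : Admissible n c) {r : ℝ} (hr : 0 < r) : ∃ k, δ k < r := by
  have hle : ∀ k, δ k ≤ (1 / 2 : ℝ) ^ k := by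
    intro k
    induction k with
    | zero => simp [compLength]
    | succ k ih =>
      have := compLength_succ_le h k
      rw [pow_succ]; linarith
  obtain ⟨k, hk⟩ := exists_pow_lt_of_lt_one hr (by norm_num : (1 / 2 : ℝ) < 1)
  exact ⟨k, (hle k).trans_lt hk⟩

/-- The first summand of the constant pays for the part of the ball inside the component. Each of
the two spills costs `A ^ 2` to bring it inside, then `(1 + 2 * A) ^ 12` to pass from radius 4r to
`r`. -/
theorem doublingWith_of_gapComparable (h : Admissible n c) (hP : IsMatching n P)
    (hm : IsMass n c P m) (hA : 1 ≤ A)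
    (hU : ∀ k, SumUniform A 1 (n (k + 1)) (prefixSum (P (k + 1))))
    (hG : GapComparable n c P A) :
    DoublingWith n c m ((1 + 2 * A) ^ 6 + 2 * (A ^ 2 * (1 + 2 * A) ^ 12)) := by
  classical
  intro x hx r hr
  have hB : 0 ≤ A ^ 2 * (1 + 2 * A) ^ 12 :=
    mul_nonneg (sq_nonneg A) (pow_nonneg (by linarith) 12)
  have hB6 : 0 ≤ (1 + 2 * A) ^ 6 := pow_nonneg (by linarith) 6
  have hex := exists_compLength_lt h (show 0 < 2 * r by linarith)
  have hmr := hm.nonneg (Metric.ball x r)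
  rcases Nat.eq_zero_or_eq_succ_pred (Nat.find hex) with h0 | h0
  · have h1 := Nat.find_spec hex
    rw [h0] at h1
    have hhalf := compLength_succ_le h 0
    have hone : δ 0 = 1 := rfl
    have hin : ∀ y ∈ E, y ∈ component n c (.nil : Word n 0) := by
      intro y hy
      obtain ⟨v, hv⟩ := exists_component hy 0
      cases v
      exact hv
    have key := doubling_inside h hP hm hA hU .nil hx (hin x hx) (r := r) (by linarith)
    calc _ ≤ m (Metric.ball x (2 * r) ∩ component n c (.nil : Word n 0)) :=
          hm.mono fun y hy => ⟨hy.1, hin y hy.2⟩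
      _ ≤ _ := key
      _ ≤ (1 + 2 * A) ^ 6 * m (Metric.ball x r) :=
          mul_le_mul_of_nonneg_left (hm.mono fun y hy => hy.1.1) hB6
      _ ≤ _ := mul_le_mul_of_nonneg_right (by linarith) hmr
  · obtain ⟨K, hK⟩ : ∃ K, Nat.find hex = K + 1 := ⟨_, h0⟩
    have h1 := Nat.find_spec hex
    have h2 := Nat.find_min hex (m := K) (by omega)
    rw [hK] at h1
    rw [not_lt] at h2
    obtain ⟨w, hxw⟩ := exists_component hx K
    have t0 := doubling_inside h hP hm hA hU w hx hxw h1
    have t1 := doubling_inside_twice h hP hm hA hU w hx hxw h1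
    have t2 := ball_inter_right_le h hP hm hA hG w hxw h1 h2
    have t3 := ball_inter_left_le h hP hm hA hG w hxw h1 h2
    have t4 : m (Metric.ball x r ∩ component n c w) ≤ m (Metric.ball x r) :=
      hm.mono fun y hy => hy.1.1
    have t5 := mul_le_mul_of_nonneg_left t1 (sq_nonneg A)
    have t6 := mul_le_mul_of_nonneg_left t4 hB
    have t7 := mul_le_mul_of_nonneg_left t4 hB6
    set U := Metric.ball x (2 * r) with hU'
    have cover : m U ≤ m (U ∩ component n c w ∪
        (U ∩ Set.Ioi (leftEnd n c w + δ K) ∪ U ∩ Set.Iio (leftEnd n c w))) := by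
      refine hm.mono fun y hy => ?_
      rcases lt_or_ge y (leftEnd n c w) with g | g
      · exact Or.inr (Or.inr ⟨hy.1, g⟩)
      · rcases lt_or_ge (leftEnd n c w + δ K) y with g' | g'
        · exact Or.inr (Or.inl ⟨hy.1, g'⟩)
        · exact Or.inl ⟨hy.1, g, g'⟩
    have u1 := hm.union_le (U ∩ component n c w)
      (U ∩ Set.Ioi (leftEnd n c w + δ K) ∪ U ∩ Set.Iio (leftEnd n c w))
    have u2 := hm.union_le (U ∩ Set.Ioi (leftEnd n c w + δ K)) (U ∩ Set.Iio (leftEnd n c w))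
    linarith

theorem doublingWith_of_conditions (h : Admissible n c) (hP : IsMatching n P)
    (hm : IsMass n c P m) {C : ℝ} (hC : 1 < C)
    (hunif : ∀ k : ℕ, 1 ≤ k → IsUniform C (n k) (P k))
    (hgap : ∀ k ∈ Lam n c,
        (∀ t : ℕ, 1 ≤ t → t < mIndex n c k →
          IsUniform C (2 * n (k + t)) (dbl (n (k + t)) (P (k + t))) ∧
          C⁻¹ * ∏ j ∈ Finset.Icc 1 t, P (k + j) 1
            ≤ ∏ j ∈ Finset.Icc 1 t, P (k + j) (n (k + j)) ∧
          ∏ j ∈ Finset.Icc 1 t, P (k + j) (n (k + j))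
            ≤ C * ∏ j ∈ Finset.Icc 1 t, P (k + j) 1) ∧
        IsUniformFrom C (sIndex n c k) (2 * n (k + mIndex n c k))
          (dbl (n (k + mIndex n c k)) (P (k + mIndex n c k)))) :
    ∃ K : ℝ, 1 ≤ K ∧ DoublingWith n c m K := by
  have hC0 : 0 < C := by linarith
  have hCC : C ≤ C ^ 2 := le_self_pow₀ hC.le (by omega)
  have hA : 1 ≤ C ^ 2 := one_le_pow₀ hC.le
  have hU : ∀ k, SumUniform C 1 (n (k + 1)) (prefixSum (P (k + 1))) := fun k =>
    (isUniformFrom_iff hC0 le_rfl (hP.pos k)).1 (hunif (k + 1) (by omega))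
  -- For neighbours, one factor `C` comes from the entries p_{k,i}, p_{k,i+1} and one from the
  -- products in (a).
  have hG : GapComparable n c P (C ^ 2) := by
    refine ⟨?_, ?_⟩
    · intro k i K w w' hk hw hK
      obtain ⟨b1, b2, b3, b4⟩ := hw.bounds
      obtain ⟨t, rfl⟩ : ∃ t, K = k + t := ⟨K - k, by omega⟩
      obtain ⟨M, hM, e1, e2⟩ := hw.mass_eq hP
      rw [prod_Ioc_eq (fun j => P j (n j))] at e1
      rw [prod_Ioc_eq (fun j => P j 1)] at e2
      have α0 : 0 < ∏ j ∈ Finset.Icc 1 t, P (k + j) 1 := by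
        refine Finset.prod_pos fun j hj => ?_
        obtain ⟨j, rfl⟩ : ∃ a, j = a + 1 := ⟨j - 1, by rw [Finset.mem_Icc] at hj; omega⟩
        exact hP.pos (k + j) _ (one_mem h _)
      have β0 : 0 < ∏ j ∈ Finset.Icc 1 t, P (k + j) (n (k + j)) := by
        refine Finset.prod_pos fun j hj => ?_
        obtain ⟨j, rfl⟩ : ∃ a, j = a + 1 := ⟨j - 1, by rw [Finset.mem_Icc] at hj; omega⟩
        exact hP.pos (k + j) _ (last_mem h _)
      have hαβ : ∏ j ∈ Finset.Icc 1 t, P (k + j) 1 ≤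
            C * ∏ j ∈ Finset.Icc 1 t, P (k + j) (n (k + j)) ∧
          ∏ j ∈ Finset.Icc 1 t, P (k + j) (n (k + j)) ≤
            C * ∏ j ∈ Finset.Icc 1 t, P (k + j) 1 := by
        rcases Nat.eq_zero_or_pos t with rfl | ht
        · simpa using hC.le
        · obtain ⟨-, g1, g2⟩ := (hgap k hk).1 t ht (by omega)
          exact ⟨(inv_mul_le_iff₀ hC0).1 g1, g2⟩
      obtain ⟨k₁, rfl⟩ : ∃ j, k = j + 1 := ⟨k - 1, by omega⟩
      have hp : P (k₁ + 1) i ≤ C * P (k₁ + 1) (i + 1) ∧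
          P (k₁ + 1) (i + 1) ≤ C * P (k₁ + 1) i := by
        obtain ⟨i, rfl⟩ : ∃ a, i = a + 1 := ⟨i - 1, by omega⟩
        have := hU k₁ i (i + 1) 1 le_rfl (by omega) (by omega) (by omega)
        simpa [prefixSum_succ] using this
      have p1 := hP.pos k₁ i (Finset.mem_Icc.2 ⟨b3, by omega⟩)
      have p2 := hP.pos k₁ (i + 1) (Finset.mem_Icc.2 ⟨by omega, b4⟩)
      set α := ∏ j ∈ Finset.Icc 1 t, P (k₁ + 1 + j) 1
      set β := ∏ j ∈ Finset.Icc 1 t, P (k₁ + 1 + j) (n (k₁ + 1 + j))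
      rw [e1, e2]
      constructor
      · calc M * P (k₁ + 1) i * β ≤ M * (C * P (k₁ + 1) (i + 1)) * (C * α) := by
              gcongr
              · exact hp.1
              · exact hαβ.2
          _ = _ := by ring
      · calc M * P (k₁ + 1) (i + 1) * α ≤ M * (C * P (k₁ + 1) i) * (C * β) := by
              gcongr
              · exact hp.2
              · exact hαβ.1
          _ = _ := by ring
    · intro k K l hk hkK hKm hl hln hs
      obtain ⟨t, ht⟩ : ∃ t, K + 1 = k + t := ⟨K + 1 - k, by omega⟩
      have F0 : 0 ≤ prefixSum (P (K + 1)) l := prefixSum_nonneg (hP.pos K) hln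
      have G0 : 0 ≤ 1 - prefixSum (P (K + 1)) (n (K + 1) - l) := by
        rw [← hP.prefixSum_eq_one K]
        exact sub_nonneg.2 (prefixSum_le (hP.pos K) (by omega) le_rfl)
      obtain ⟨s, s1, sl, hdbl⟩ : ∃ s, 1 ≤ s ∧ s ≤ l ∧
          IsUniformFrom C s (2 * n (K + 1)) (dbl (n (K + 1)) (P (K + 1))) := by
        rw [ht] at hKm hs ⊢
        rcases (show t ≤ mIndex n c k by omega).lt_or_eq with hlt | heq
        · exact ⟨1, le_rfl, hl, ((hgap k hk).1 t (by omega) hlt).1⟩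
        · subst heq
          exact ⟨_, (isS_sIndex h hk).1, hs rfl, (hgap k hk).2⟩
      rw [isUniformFrom_iff hC0 s1 (dbl_pos (hP.pos K))] at hdbl
      -- The last `l` entries of the first copy against the first `l` of the second, adjacent at the
      -- junction of (v,v).
      have key := hdbl (n (K + 1) - l) (n (K + 1)) l sl (by omega) (by omega) (by omega)
      rw [Nat.sub_add_cancel hln, prefixSum_dbl_add, prefixSum_dbl_of_le _ le_rfl,
        prefixSum_dbl_of_le _ (by omega), hP.prefixSum_eq_one, add_sub_cancel_left] at key
      exact ⟨key.2.trans (mul_le_mul_of_nonneg_right hCC G0),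
        key.1.trans (mul_le_mul_of_nonneg_right hCC F0)⟩
  refine ⟨_, ?_, doublingWith_of_gapComparable h hP hm hA
    (fun k => (hU k).mono hCC fun _ _ => prefixSum_le (hP.pos k)) hG⟩
  have h1 : 1 ≤ (1 + 2 * C ^ 2) ^ 6 := one_le_pow₀ (by linarith)
  have h2 : 0 ≤ (C ^ 2) ^ 2 * (1 + 2 * C ^ 2) ^ 12 := by positivity
  linarith

end Sufficiency

/-! ### Uniqueness of the measure, and doubling in real-valued form. -/

section Uniqueness

theorem isOpen_component (h : Admissible n c) {k : ℕ} (w : Word n k) :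
    IsOpen ((Subtype.val : E → ℝ) ⁻¹' component n c w) := by
  obtain ⟨η, hη, hs⟩ := exists_separation h k
  refine Metric.isOpen_iff.2 fun x hx => ⟨η, hη, fun y hy => ?_⟩
  obtain ⟨v, hv⟩ := exists_component y.2 k
  by_cases hvw : w = v
  · rw [hvw]; exact hv
  · exfalso
    rw [Metric.mem_ball, Subtype.dist_eq, Real.dist_eq, abs_lt] at hy
    have h1 := hx.1; have h2 := hx.2; have h3 := hv.1; have h4 := hv.2
    rcases hs w v hvw with h5 | h5 <;> linarith [hy.1, hy.2]

/-- The sets `I_w ∩ E`, as subsets of `E`. -/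
def cylinders (n : ℕ → ℕ) (c : ℕ → ℝ) : Set (Set (cantorSet n c)) :=
  {S | ∃ (k : ℕ) (w : Word n k), S = Subtype.val ⁻¹' component n c w}

theorem component_subset_or_disjoint (h : Admissible n c) {j k : ℕ} (hjk : j ≤ k) (v : Word n j)
    (w : Word n k) : component n c w ⊆ component n c v ∨
      Disjoint (component n c w) (component n c v) := by
  induction k, hjk using Nat.le_induction with
  | base =>
    by_cases hvw : v = w
    · left; rw [hvw]
    · right
      refine Set.disjoint_left.2 fun x hx hx' => hvw (eq_of_mem h hx' hx)
  | succ k _ ih =>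
    cases w with | snoc w a ha =>
    have hsub : component n c (w.snoc a ha) ⊆ component n c w := child_subset h w ha
    rcases ih w with h1 | h1
    · exact Or.inl (hsub.trans h1)
    · exact Or.inr (h1.mono_left hsub)

theorem isPiSystem_cylinders (h : Admissible n c) : IsPiSystem (cylinders n c) := by
  rintro _ ⟨j, v, rfl⟩ _ ⟨k, w, rfl⟩ hne
  rw [← Set.preimage_inter] at hne ⊢
  have hne' : ¬ Disjoint (component n c v) (component n c w) := by
    obtain ⟨x, hx⟩ := hne
    exact fun hd => Set.disjoint_left.1 hd hx.1 hx.2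
  rcases le_total j k with hjk | hjk
  · rcases component_subset_or_disjoint h hjk v w with h1 | h1
    · exact ⟨k, w, by rw [Set.inter_eq_right.2 h1]⟩
    · exact absurd h1.symm hne'
  · rcases component_subset_or_disjoint h hjk w v with h1 | h1
    · exact ⟨j, v, by rw [Set.inter_eq_left.2 h1]⟩
    · exact absurd h1 hne'

/-- Components shrink to points and are relatively open, so cylinders form a basis and generate the
Borel σ-algebra. -/
theorem isTopologicalBasis_cylinders (h : Admissible n c) :
    TopologicalSpace.IsTopologicalBasis (cylinders n c) := by
  refine TopologicalSpace.isTopologicalBasis_of_isOpen_of_nhds ?_ ?_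
  · rintro _ ⟨k, w, rfl⟩
    exact isOpen_component h w
  · intro x U hx hU
    obtain ⟨r, hr, hrU⟩ := Metric.isOpen_iff.1 hU x hx
    obtain ⟨k, hk⟩ := exists_compLength_lt h hr
    obtain ⟨w, hw⟩ := exists_component x.2 k
    refine ⟨_, ⟨k, w, rfl⟩, hw, fun y hy => hrU ?_⟩
    rw [Metric.mem_ball, Subtype.dist_eq, Real.dist_eq, abs_lt]
    have h1 := hw.1; have h2 := hw.2; have h3 := hy.1; have h4 := hy.2
    constructor <;> linarith

theorem IsMuP.apply_component (hP : IsMatching n P) {μ : Measure E} (hμ : IsMuP n c P μ) {k : ℕ}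
    (w : Word n k) : μ (Subtype.val ⁻¹' component n c w) = ENNReal.ofReal (mass P w) := by
  induction w with
  | nil =>
    have hpr := hμ.1
    have huniv : (Subtype.val : E → ℝ) ⁻¹' component n c (.nil : Word n 0) = Set.univ := by
      refine Set.eq_univ_of_forall fun y => ?_
      obtain ⟨v, hv⟩ := exists_component y.2 0
      cases v
      exact hv
    rw [huniv, measure_univ, mass, ENNReal.ofReal_one]
  | snoc w i hi ih =>
    rw [hμ.2, ih, mass, ENNReal.ofReal_mul (hP.pos _ i hi).le]

theorem IsMuP.unique (h : Admissible n c) (hP : IsMatching n P) {μ ν : Measure E}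
    (hμ : IsMuP n c P μ) (hν : IsMuP n c P ν) : μ = ν := by
  have := hμ.1
  have := hν.1
  refine ext_of_generate_finite (cylinders n c) ?_ (isPiSystem_cylinders h) ?_ (by simp)
  · rw [← (isTopologicalBasis_cylinders h).borel_eq_generateFrom]
    exact BorelSpace.measurable_eq
  · rintro _ ⟨k, w, rfl⟩
    rw [hμ.apply_component hP, hν.apply_component hP]

theorem IsMuP.isMass (h : Admissible n c) (hP : IsMatching n P) {μ : Measure E}
    (hμ : IsMuP n c P μ) : IsMass n c P fun S => μ.real (Subtype.val ⁻¹' S) where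
  mono := by
    intro S T hST
    have := hμ.1
    exact measureReal_mono fun x hx => hST ⟨hx, x.2⟩
  union_le S T := by
    have := hμ.1
    simpa using measureReal_union_le (μ := μ) (Subtype.val ⁻¹' S) (Subtype.val ⁻¹' T)
  component w := by
    rw [measureReal_def, hμ.apply_component hP, ENNReal.toReal_ofReal (mass_pos hP w).le]
  children := by
    intro k w s hs
    have := hμ.1
    simp only [Set.preimage_iUnion]
    rw [measureReal_biUnion_finset, Finset.mul_sum]
    · refine Finset.sum_congr rfl fun a ha => ?_
      rw [← component_snoc w a (hs ha), measureReal_def, hμ.apply_component hP,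
        ENNReal.toReal_ofReal (mass_pos hP _).le, mass_snoc, mul_comm]
    · intro a ha b hb hab
      refine Set.disjoint_left.2 fun x hx hx' => hab ?_
      have e := eq_of_mem h (w := w.snoc a (hs ha)) (w' := w.snoc b (hs hb)) hx hx'
      injection e
    · intro a ha
      exact measurable_subtype_coe measurableSet_Icc

/-- Finiteness holds because the measure is a probability, and positivity because every ball
contains a cylinder of positive mass; only the inequality remains. -/
theorem isDoubling_iff (h : Admissible n c) (hP : IsMatching n P) {μ : Measure E}
    (hμ : IsMuP n c P μ) : IsDoubling μ ↔
      ∃ K : ℝ, 1 ≤ K ∧ DoublingWith n c (fun S => μ.real (Subtype.val ⁻¹' S)) K := by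
  have := hμ.1
  constructor
  · rintro ⟨K, hK, hd⟩
    refine ⟨K, by exact_mod_cast hK, fun x hx r hr => ?_⟩
    obtain ⟨-, h1, h2⟩ := hd ⟨x, hx⟩ r hr
    have h3 := ENNReal.toReal_mono h2.ne h1
    rw [ENNReal.toReal_mul] at h3
    exact h3
  · rintro ⟨K, hK, hd⟩
    have hK0 : 0 ≤ K := by linarith
    refine ⟨⟨K, hK0⟩, by exact_mod_cast hK, fun x r hr => ⟨?_, ?_, ?_⟩⟩
    · obtain ⟨k, hk⟩ := exists_compLength_lt h (show 0 < 2 * r by linarith)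
      obtain ⟨w, hw⟩ := exists_component x.2 k
      have h1 : 0 < μ (Subtype.val ⁻¹' component n c w) := by
        rw [hμ.apply_component hP]
        exact ENNReal.ofReal_pos.2 (mass_pos hP w)
      refine h1.trans_le (measure_mono fun y hy => ?_)
      rw [Metric.mem_ball, Subtype.dist_eq, Real.dist_eq, abs_lt]
      have h1 := hw.1; have h2 := hw.2; have h3 := hy.1; have h4 := hy.2
      constructor <;> linarith
    · have h1 := hd x x.2 r hr
      refine (ENNReal.toReal_le_toReal (measure_ne_top μ _)
        (ENNReal.mul_ne_top ENNReal.coe_ne_top (measure_ne_top μ _))).1 ?_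
      rw [ENNReal.toReal_mul]
      exact h1
    · exact ENNReal.mul_lt_top ENNReal.coe_lt_top (measure_lt_top μ _)

end Uniqueness

/-! ### Existence: coding `E` by digit sequences. -/

section Existence

/-- The word formed by the first `k` digits of a sequence. -/
def initialWord (ω : ∀ k : ℕ, Fin (n (k + 1))) : (k : ℕ) → Word n k
  | 0 => .nil
  -- Elements of `Fin` count from 0, digits of words from 1.
  | k + 1 => (initialWord ω k).snoc (ω k + 1) (Finset.mem_Icc.2 ⟨by omega, (ω k).isLt⟩)

/-- The point of `E` with a given digit sequence. -/
def pointOf (n : ℕ → ℕ) (c : ℕ → ℝ) (ω : ∀ k : ℕ, Fin (n (k + 1))) : ℝ :=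
  ⨆ k, leftEnd n c (initialWord ω k)

theorem component_initialWord_succ_subset (h : Admissible n c) (ω : ∀ k : ℕ, Fin (n (k + 1)))
    (k : ℕ) : component n c (initialWord ω (k + 1)) ⊆ component n c (initialWord ω k) :=
  child_subset h _ (Finset.mem_Icc.2 ⟨by omega, (ω k).isLt⟩)

/-- The components are nested, so every left endpoint is bounded by every right endpoint, and the
supremum lies between them. -/
theorem pointOf_mem_component (h : Admissible n c) (ω : ∀ k : ℕ, Fin (n (k + 1))) (k : ℕ) :
    pointOf n c ω ∈ component n c (initialWord ω k) := by
  have hanti : Antitone fun k => component n c (initialWord ω k) :=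
    antitone_nat_of_succ_le (component_initialWord_succ_subset h ω)
  have hub : ∀ j, leftEnd n c (initialWord ω j) ≤ leftEnd n c (initialWord ω k) + δ k := by
    intro j
    have h1 := hanti (le_max_left j k) (leftEnd_mem h (initialWord ω (max j k)))
    have h2 := hanti (le_max_right j k) (leftEnd_mem h (initialWord ω (max j k)))
    exact h1.1.trans h2.2
  exact ⟨le_ciSup ⟨_, by rintro _ ⟨j, rfl⟩; exact hub j⟩ k, ciSup_le hub⟩

theorem pointOf_mem (h : Admissible n c) (ω : ∀ k : ℕ, Fin (n (k + 1))) : pointOf n c ω ∈ E :=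
  Set.mem_iInter.2 fun k => Set.mem_iUnion.2 ⟨_, pointOf_mem_component h ω k⟩

theorem measurable_leftEnd_initialWord (k : ℕ) :
    Measurable fun ω : ∀ k : ℕ, Fin (n (k + 1)) => leftEnd n c (initialWord ω k) := by
  induction k with
  | zero => exact measurable_const
  | succ k ih =>
    simp only [initialWord, leftEnd_snoc]
    refine ih.add ?_
    exact (measurable_of_finite fun i : Fin (n (k + 1)) =>
      (((i : ℕ) + 1 : ℕ) - 1 : ℝ) * τ (k + 1)).comp (measurable_pi_apply k)

theorem measurable_pointOf : Measurable (pointOf n c) :=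
  Measurable.iSup measurable_leftEnd_initialWord

/-- The digits of a word, with `digit w j` the digit of level `j + 1`. -/
def digit : {k : ℕ} → Word n k → ℕ → ℕ
  -- A default value: only digits `j < k` of a word of length `k` are used.
  | _, .nil, _ => 0
  | _, .snoc (k := k) w i _, j => if j = k then i else digit w j

theorem initialWord_eq_iff (ω : ∀ k : ℕ, Fin (n (k + 1))) {k : ℕ} (w : Word n k) :
    initialWord ω k = w ↔ ∀ j < k, (ω j : ℕ) + 1 = digit w j := by
  induction w with
  | nil => simp [initialWord]
  | @snoc k w i hi ih =>
    rw [initialWord, Word.snoc.injEq, ih]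
    constructor
    · rintro ⟨h1, h2⟩ j hj
      rw [digit]
      split_ifs with hjk
      · subst hjk; exact h2
      · exact h1 j (by omega)
    · intro h1
      refine ⟨fun j hj => ?_, ?_⟩
      · have := h1 j (by omega)
        rwa [digit, if_neg hj.ne] at this
      · have := h1 k (by omega)
        rwa [digit, if_pos rfl] at this

/-- The distribution of the digit of level `k + 1`. -/
def digitMeasure (n : ℕ → ℕ) (P : ℕ → ℕ → ℝ) (k : ℕ) : Measure (Fin (n (k + 1))) :=
  ∑ i : Fin (n (k + 1)), ENNReal.ofReal (P (k + 1) (i + 1)) • Measure.dirac i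

theorem digitMeasure_singleton {k i : ℕ} (hi : i ∈ Finset.Icc 1 (n (k + 1))) :
    digitMeasure n P k {x | (x : ℕ) + 1 = i} = ENNReal.ofReal (P (k + 1) i) := by
  rw [Finset.mem_Icc] at hi
  rw [digitMeasure, Measure.finsetSum_apply, Finset.sum_eq_single ⟨i - 1, by omega⟩]
  · simp [Set.indicator, Nat.sub_add_cancel hi.1]
  · intro b _ hb
    have : (b : ℕ) + 1 ≠ i := fun e => hb (Fin.ext (by simp; omega))
    simp [Set.indicator, this]
  · simp

theorem prefixSum_eq_sum_fin (v : ℕ → ℝ) (N : ℕ) :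
    prefixSum v N = ∑ i : Fin N, v (i + 1) := by
  induction N with
  | zero => simp
  | succ N ih => rw [prefixSum_succ, ih, Fin.sum_univ_castSucc]; simp

theorem isProbabilityMeasure_digitMeasure (hP : IsMatching n P) (k : ℕ) :
    IsProbabilityMeasure (digitMeasure n P k) := by
  constructor
  rw [digitMeasure, Measure.finsetSum_apply]
  simp only [Measure.smul_apply, measure_univ, smul_eq_mul, mul_one]
  rw [← ENNReal.ofReal_sum_of_nonneg, ENNReal.ofReal_eq_one, ← hP.prefixSum_eq_one k,
    prefixSum_eq_sum_fin]
  · intro i _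
    exact (hP.pos k _ (Finset.mem_Icc.2 ⟨by omega, i.isLt⟩)).le

/-- Independent digits with distributions P_1, P_2, … are pushed forward by the coding map. A
component pulls back to a cylinder fixing finitely many digits, whose product measure is the product
of the corresponding entries. -/
theorem exists_isMuP (h : Admissible n c) (hP : IsMatching n P) :
    ∃ μ : Measure E, IsMuP n c P μ := by
  have := isProbabilityMeasure_digitMeasure hP
  let Q := Measure.infinitePi (digitMeasure n P)
  let f : (∀ k : ℕ, Fin (n (k + 1))) → E := fun ω => ⟨pointOf n c ω, pointOf_mem h ω⟩
  have hf : Measurable f := measurable_pointOf.subtype_mk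
  have hval : ∀ {k : ℕ} (w : Word n k), Q.map f (Subtype.val ⁻¹' component n c w) =
      ∏ j ∈ Finset.range k, digitMeasure n P j {x | (x : ℕ) + 1 = digit w j} := by
    intro k w
    have hmeas : MeasurableSet ((Subtype.val : E → ℝ) ⁻¹' component n c w) :=
      measurable_subtype_coe measurableSet_Icc
    rw [Measure.map_apply hf hmeas]
    have e : f ⁻¹' (Subtype.val ⁻¹' component n c w) =
        Set.pi (Finset.range k) fun j => {x : Fin (n (j + 1)) | (x : ℕ) + 1 = digit w j} := by
      ext ω
      have h1 : ω ∈ f ⁻¹' (Subtype.val ⁻¹' component n c w) ↔ initialWord ω k = w :=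
        ⟨fun hω => eq_of_mem h (pointOf_mem_component h ω k) hω,
          fun e => e ▸ pointOf_mem_component h ω k⟩
      rw [h1, initialWord_eq_iff]
      simp [Set.mem_pi]
    rw [e, Measure.infinitePi_pi]
    exact fun _ _ => MeasurableSet.of_discrete
  refine ⟨Q.map f, Measure.isProbabilityMeasure_map hf.aemeasurable, fun k w i hi => ?_⟩
  rw [hval, hval, Finset.prod_range_succ, mul_comm]
  congr 1
  · rw [digit, if_pos rfl, digitMeasure_singleton hi]
  · refine Finset.prod_congr rfl fun j hj => ?_
    rw [digit, if_neg (Finset.mem_range.1 hj).ne]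

end Existence

end

end UniformCantor

theorem theorem1 (n : ℕ → ℕ) (c : ℕ → ℝ) (hnc : UniformCantor.Admissible n c)
    (P : ℕ → ℕ → ℝ) (hP : UniformCantor.IsMatching n P) :
    (∃! μ : MeasureTheory.Measure (UniformCantor.cantorSet n c), UniformCantor.IsMuP n c P μ) ∧
    ∀ μ : MeasureTheory.Measure (UniformCantor.cantorSet n c), UniformCantor.IsMuP n c P μ →
      (UniformCantor.IsDoubling μ ↔
        ∃ C : ℝ, 1 < C ∧
          (∀ k : ℕ, 1 ≤ k → UniformCantor.IsUniform C (n k) (P k)) ∧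
          ∀ k ∈ UniformCantor.Lam n c,
            (∀ t : ℕ, 1 ≤ t → t < UniformCantor.mIndex n c k →
              UniformCantor.IsUniform C (2 * n (k + t))
                (UniformCantor.dbl (n (k + t)) (P (k + t))) ∧
              C⁻¹ * ∏ j ∈ Finset.Icc 1 t, P (k + j) 1
                ≤ ∏ j ∈ Finset.Icc 1 t, P (k + j) (n (k + j)) ∧
              ∏ j ∈ Finset.Icc 1 t, P (k + j) (n (k + j))
                ≤ C * ∏ j ∈ Finset.Icc 1 t, P (k + j) 1) ∧
            UniformCantor.IsUniformFrom C (UniformCantor.sIndex n c k)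
              (2 * n (k + UniformCantor.mIndex n c k))
              (UniformCantor.dbl (n (k + UniformCantor.mIndex n c k))
                (P (k + UniformCantor.mIndex n c k)))) := by
  refine ⟨?_, fun μ hμ => ?_⟩
  · obtain ⟨μ, hμ⟩ := UniformCantor.exists_isMuP hnc hP
    exact ⟨μ, hμ, fun ν hν => hν.unique hnc hP hμ⟩
  · rw [UniformCantor.isDoubling_iff hnc hP hμ]
    constructor
    · rintro ⟨K, hK, hd⟩
      exact UniformCantor.conditions_of_doubling hnc hP (hμ.isMass hnc hP) hK hd
    · rintro ⟨C, hC, h1, h2⟩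
      exact UniformCantor.doublingWith_of_conditions hnc hP (hμ.isMass hnc hP) hC h1 h2
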